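/- Fix $m\ge 1$. For each sample size $n$, let $X_1,\dots,X_n$ be random vectors in $\mathbb{R}^m$ defined on a probability space that may depend on $n$ (a triangular array: the joint law of $\mathbf{X}=(X_1,\dots,X_n)$ may depend on $n$ and the dependence among the $X_i$ is arbitrary), let $\mu_0=\mu_{0,n}\in\mathbb{R}^m$ be nonrandom, and let $R_n\ge 1$ be an integer. Let $\pi=(\pi_r)_{r=1}^{R_n}$ be i.i.d. uniform random permutations of $\{1,\dots,n\}$, independent of $\mathbf{X}$. Write $\bar X=n^{-1}\sum_{i=1}^n X_i$ and $\hat\Sigma=n^{-1}\sum_{i=1}^n(X_i-\bar X)(X_i-\bar X)'$, and for $\mu\in\mathbb{R}^m$ and $n\ge 2$ define $$\tilde T_M(\mu;\pi)=\frac1{\sqrt{R_n}}\sum_{r=1}^{R_n}\hat\Sigma^{-1/2}(X_{\pi_r(1)}-\mu),\qquad T_M(\mu;\pi)=\tilde T_M(\mu;\pi)'\,\tilde T_M(\mu;\pi),$$ $$T_U(\mu;\pi)=\frac1{\sqrt{mR_n}}\sum_{r=1}^{R_n}(X_{\pi_r(1)}-\mu)'\hat\Sigma^{-1}(X_{\pi_r(2)}-\mu),$$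 where $\hat\Sigma^{-1/2}$ is the inverse of the positive semidefinite square root of $\hat\Sigma$ (inverses of singular matrices are read as $0$). Suppose that, as $n\to\infty$, with $\|\cdot\|$ the sup norm, (a) $n^{-1/2}\sum_{i=1}^n(X_i-\mu_0)=O_p(1)$; (b) $\hat\Sigma\to\Sigma$ in probability for some (nonrandom, fixed) positive-definite matrix $\Sigma$; (c) $n^{-1}\sum_{i=1}^n\|X_i\|^{2+\delta}=O_p(1)$ for some $\delta>0$. Let $R_n\to\infty$. 1. If $R_n/n\to0$, then for $T_n=\tilde T_M(\mu_0;\pi)$ and for $T_n=\tilde T_M(\bar X;\pi)$ the conditional CDF $\mathbf P(T_n\le t\mid\mathbf{X})$ (componentwise order) converges in probability, for every $t\in\mathbb{R}^m$, to the CDF of $\mathcal N(0,I_m)$ at $t$. Moreover $T_M(\mu_0;\pi)$ and $T_M(\bar X;\pi)$ converge in distribution to $\chi^2_m$, the chi-square distribution with $m$ degrees of freedom, and for $T_n$ equal to either of them $$\sup_{t\in\mathbb{R}}\big|\mathbf P(T_n\le t\mid\mathbf{X})-\chi^2_m((-\infty,t])\big|\to0\quad\text{in probability}.$$ 2. If $\sqrt{R_n}/n\to0$,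 then $T_U(\mu_0;\pi)$ and $T_U(\bar X;\pi)$ converge in distribution to $\mathcal N(0,1)$, and for $T_n$ equal to either of them, with $\Phi$ the standard normal CDF, $$\sup_{t\in\mathbb{R}}\big|\mathbf P(T_n\le t\mid\mathbf{X})-\Phi(t)\big|\to0\quad\text{in probability}.$$ -/

import Mathlib

open MeasureTheory ProbabilityTheory Filter Topology

noncomputable section

namespace Resampling

section Statistics

/-- Permutations of a finite set carry the discrete σ-algebra. -/
instance permMeasurableSpace (n : ℕ) : MeasurableSpace (Equiv.Perm (Fin n)) := ⊤

instance permDiscreteMeasurableSpace (n : ℕ) :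
    DiscreteMeasurableSpace (Equiv.Perm (Fin n)) := ⟨fun _ => trivial⟩

/-- The sample mean of the data set `x 0, …, x (n - 1)` in `ℝ^m`. -/
def sampleMean {n m : ℕ} (x : Fin n → Fin m → ℝ) : Fin m → ℝ :=
  (n : ℝ)⁻¹ • ∑ i, x i

/-- The (naive) sample variance matrix `n⁻¹ ∑ᵢ (xᵢ - x̄) (xᵢ - x̄)'`. -/
def sampleVar {n m : ℕ} (x : Fin n → Fin m → ℝ) : Matrix (Fin m) (Fin m) ℝ :=
  (n : ℝ)⁻¹ • ∑ i, Matrix.vecMulVec (x i - sampleMean x) (x i - sampleMean x)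

/-- The observation `x_{σ(k+1)}` (positions are counted from `0` here). The value `0` is used for
`n ≤ k` only; as `k` is `0` or `1` below, this concerns only the sample sizes `n < 2`. -/
def drawn {n m : ℕ} (x : Fin n → Fin m → ℝ) (σ : Equiv.Perm (Fin n)) (k : ℕ) : Fin m → ℝ :=
  if h : k < n then x (σ ⟨k, h⟩) else 0

open scoped MatrixOrder in
/-- `S^{-1/2}`: the inverse of the positive semidefinite square root of `S`. -/
def invSqrt {m : ℕ} (S : Matrix (Fin m) (Fin m) ℝ) : Matrix (Fin m) (Fin m) ℝ :=
  (CFC.sqrt S)⁻¹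

/-- The vector `R^{-1/2} ∑ᵣ Σ̂^{-1/2} (x_{πᵣ(1)} - μ)`. -/
def meanVec {n m R : ℕ} (x : Fin n → Fin m → ℝ) (μ : Fin m → ℝ)
    (π : Fin R → Equiv.Perm (Fin n)) : Fin m → ℝ :=
  (√(R : ℝ))⁻¹ • ∑ r, Matrix.mulVec (invSqrt (sampleVar x)) (drawn x (π r) 0 - μ)

/-- The mean-type statistic `T_M(μ; π)`. -/
def meanStat {n m R : ℕ} (x : Fin n → Fin m → ℝ) (μ : Fin m → ℝ)
    (π : Fin R → Equiv.Perm (Fin n)) : ℝ :=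
  dotProduct (meanVec x μ π) (meanVec x μ π)

/-- The U-type statistic
`T_U(μ; π) = (m R)^{-1/2} ∑ᵣ (x_{πᵣ(1)} - μ)' Σ̂⁻¹ (x_{πᵣ(2)} - μ)`. -/
def uStat {n m R : ℕ} (x : Fin n → Fin m → ℝ) (μ : Fin m → ℝ)
    (π : Fin R → Equiv.Perm (Fin n)) : ℝ :=
  (√((m : ℝ) * (R : ℝ)))⁻¹ *
    ∑ r, dotProduct (drawn x (π r) 0 - μ)
      (Matrix.mulVec (sampleVar x)⁻¹ (drawn x (π r) 1 - μ))

end Statistics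

section Limits

/-- The standard normal distribution `N(0, I_m)` on `ℝ^m`. -/
def stdNormal (m : ℕ) : Measure (Fin m → ℝ) := Measure.pi fun _ => gaussianReal 0 1

instance isProbabilityMeasure_stdNormal (m : ℕ) : IsProbabilityMeasure (stdNormal m) := by
  unfold stdNormal; infer_instance

/-- The chi-square distribution with `m` degrees of freedom: the law of the sum of the squares of
`m` independent standard normal variables. -/
def chiSquare (m : ℕ) : Measure ℝ := (stdNormal m).map fun z => ∑ i, z i ^ 2

instance isProbabilityMeasure_chiSquare (m : ℕ) : IsProbabilityMeasure (chiSquare m) :=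
  Measure.isProbabilityMeasure_map
    (Finset.measurable_sum _ fun i _ => (measurable_pi_apply i).pow_const 2).aemeasurable

end Limits

section Convergence

/-- `Yₙ = O_p(1)`, where `Yₙ` lives on the `n`-th probability space. -/
def BoundedInProb {Ω : ℕ → Type*} [∀ n, MeasurableSpace (Ω n)] {E : Type*} [Norm E]
    (P : ∀ n, Measure (Ω n)) (Y : ∀ n, Ω n → E) : Prop :=
  ∀ ε : ℝ, 0 < ε → ∃ M : ℝ, ∀ᶠ n in atTop, P n {ω | M < ‖Y n ω‖} ≤ ENNReal.ofReal ε

/-- `Yₙ → c` in probability, where `Yₙ` lives on the `n`-th probability space. -/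
def TendstoInProb {Ω : ℕ → Type*} [∀ n, MeasurableSpace (Ω n)]
    (P : ∀ n, Measure (Ω n)) (Y : ∀ n, Ω n → ℝ) (c : ℝ) : Prop :=
  ∀ ε : ℝ, 0 < ε → Tendsto (fun n => P n {ω | ε < |Y n ω - c|}) atTop (𝓝 0)

/-- The conditional CDF at `t` of the statistic `T` given the data `X`, at the outcome `ω`, computed
from the regular conditional distribution of `T` given `X`. On `ℝ^m` the order is componentwise. -/
def condCDFGiven {Ω D E : Type*} [MeasurableSpace Ω] [MeasurableSpace D] [MeasurableSpace E]
    [StandardBorelSpace E] [Nonempty E] [Preorder E]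
    (P : Measure Ω) [IsFiniteMeasure P] (X : Ω → D) (T : Ω → E) (t : E) (ω : Ω) : ℝ :=
  (condDistrib T X P (X ω)).real (Set.Iic t)

/-- Conditionally on the data, the CDF of `Tₙ` converges pointwise in probability to that of `ν`. -/
def CondCDFTendsto {Ω D : ℕ → Type*} [∀ n, MeasurableSpace (Ω n)] [∀ n, MeasurableSpace (D n)]
    {E : Type*} [MeasurableSpace E] [StandardBorelSpace E] [Nonempty E] [Preorder E]
    (P : ∀ n, Measure (Ω n)) [∀ n, IsProbabilityMeasure (P n)]
    (X : ∀ n, Ω n → D n) (T : ∀ n, Ω n → E) (ν : Measure E) : Prop :=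
  ∀ t : E, TendstoInProb P (fun n ω => condCDFGiven (P n) (X n) (T n) t ω) (ν.real (Set.Iic t))

/-- Conditionally on the data, the CDF of `Tₙ` converges uniformly in probability to that
of `ν`. -/
def CondCDFTendstoUniformly {Ω D : ℕ → Type*} [∀ n, MeasurableSpace (Ω n)]
    [∀ n, MeasurableSpace (D n)]
    (P : ∀ n, Measure (Ω n)) [∀ n, IsProbabilityMeasure (P n)]
    (X : ∀ n, Ω n → D n) (T : ∀ n, Ω n → ℝ) (ν : Measure ℝ) : Prop :=
  TendstoInProb P
    (fun n ω => ⨆ t : ℝ, |condCDFGiven (P n) (X n) (T n) t ω - ν.real (Set.Iic t)|) 0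

end Convergence

end Resampling

end

noncomputable section

namespace Resampling

/-! ### Lyapunov's central limit theorem by characteristic functions -/

section CentralLimit

/-! Since the permutations are independent of the data, conditioning on the data freezes them: each
statistic becomes a normalized sum of `R` i.i.d. functions of one uniform permutation, whatever the
dependence among the observations. A Lyapunov theorem for triangular arrays,
`tendsto_integral_exp_pow`, then gives the conditional limit, provided the drift `√R · mean`
vanishes, the second moment converges and a moment of some order `p > 2` stays bounded.

All three are finite-population computations with the points `z i = Σ̂^{-1/2} (x i - μ)`, whose
covariance is exactly the identity and whose mean `d` has squared length of order `1/n`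
(`isStandardized_standardize`). One draw in direction `t` has mean `t·d`, of order `n^{-1/2}`, so
the drift vanishes when `R/n → 0`. For two draws without replacement, the mean of `z·z'` has order
`1/n`, which is why `√R/n → 0` suffices for the U-type statistic; its second moment tends to `m`,
the removed diagonal being negligible by the moment bound.

These limits hold along every deterministic sequence of data sets, of sizes tending to infinity,
that satisfies bounded versions of the assumptions. A contradiction argument makes them uniform over
good data sets of large size, and good data have probability close to one
(`TendstoAlongData.tendstoInProb`). By `condDistrib_of_indepFun` the law for frozen data is the
regular conditional law. Pólya's theorem supplies uniformity in `t`; integrating conditional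
expectations of bounded continuous functions supplies the unconditional limits. The centre `μ` may
depend on the data throughout, so `μ₀` and the sample mean share one proof. -/

lemma norm_exp_mul_I_sub_taylor_le {p : ℝ} (hp2 : 2 ≤ p) (hp3 : p ≤ 3) (x : ℝ) :
    ‖Complex.exp (x * Complex.I) - (1 + x * Complex.I - x ^ 2 / 2)‖ ≤ 4 * |x| ^ p := by
  -- For `|x| ≤ 1` the cubic Taylor remainder is at most `e |x|^3`; for `|x| > 1` each term is
  -- bounded separately by a multiple of `x^2`. Any exponent between 2 and 3 dominates in both
  -- ranges.
  rcases le_or_gt |x| 1 with hx | hx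
  · have h := Complex.norm_exp_sub_sum_le_norm_mul_exp (x * Complex.I) 3
    have hn : ‖(x * Complex.I : ℂ)‖ = |x| := by simp
    have hs : ∑ m ∈ Finset.range 3, (x * Complex.I : ℂ) ^ m / m.factorial
        = 1 + x * Complex.I - x ^ 2 / 2 := by
      simp [Finset.sum_range_succ, Nat.factorial, mul_pow]; ring
    rw [hn, hs] at h
    refine h.trans ?_
    have he : Real.exp |x| ≤ 4 := by
      have := Real.exp_le_exp.2 hx
      linarith [Real.exp_one_lt_d9]
    have h3 : |x| ^ 3 ≤ |x| ^ p := by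
      rcases eq_or_lt_of_le (abs_nonneg x) with h0 | h0
      · rw [← h0, Real.zero_rpow (by linarith)]; simp
      · rw [← Real.rpow_natCast |x| 3]
        exact Real.rpow_le_rpow_of_exponent_ge h0 hx (by exact_mod_cast hp3)
    calc |x| ^ 3 * Real.exp |x| ≤ |x| ^ p * 4 := by gcongr
      _ = 4 * |x| ^ p := by ring
  · have h2 : |x| ^ 2 ≤ |x| ^ p := by
      rw [← Real.rpow_natCast |x| 2]
      exact Real.rpow_le_rpow_of_exponent_le hx.le (by exact_mod_cast hp2)
    calc _ ≤ ‖Complex.exp (x * Complex.I)‖ + (‖(1 : ℂ)‖ + ‖(x * Complex.I : ℂ)‖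
            + ‖(x ^ 2 / 2 : ℂ)‖) := by
          refine (norm_sub_le _ _).trans ?_
          gcongr
          refine (norm_sub_le _ _).trans ?_
          gcongr
          exact norm_add_le _ _
      _ = 1 + (1 + |x| + |x| ^ 2 / 2) := by
          rw [Complex.norm_exp_ofReal_mul_I]; simp
      _ ≤ 4 * |x| ^ 2 := by nlinarith
      _ ≤ _ := by gcongr

/-- Telescoping. It reduces the comparison of characteristic functions of whole rows to that of
single entries, with no complex logarithm. -/
lemma norm_pow_sub_pow_le_of_norm_le_one {a b : ℂ} (ha : ‖a‖ ≤ 1) (hb : ‖b‖ ≤ 1) (N : ℕ) :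
    ‖a ^ N - b ^ N‖ ≤ N * ‖a - b‖ := by
  induction N with
  | zero => simp
  | succ N ih =>
    have : a ^ (N + 1) - b ^ (N + 1) = a ^ N * (a - b) + (a ^ N - b ^ N) * b := by ring
    rw [this]
    refine (norm_add_le _ _).trans ?_
    rw [norm_mul, norm_mul, norm_pow]
    have h1 : ‖a‖ ^ N ≤ 1 := pow_le_one₀ (norm_nonneg _) ha
    push_cast
    nlinarith [norm_nonneg (a - b), norm_nonneg (a ^ N - b ^ N)]

variable {G : Type*} [MeasurableSpace G] [Finite G] [DiscreteMeasurableSpace G]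

lemma norm_integral_exp_sub_taylor_le (ν : Measure G) [IsProbabilityMeasure ν] (W : G → ℝ)
    {p : ℝ} (hp2 : 2 ≤ p) (hp3 : p ≤ 3) :
    ‖∫ g, Complex.exp (W g * Complex.I) ∂ν
        - (1 + (∫ g, W g ∂ν : ℝ) * Complex.I - (∫ g, W g ^ 2 ∂ν : ℝ) / 2)‖
      ≤ 4 * ∫ g, |W g| ^ p ∂ν := by
  have h : (1 + (∫ g, W g ∂ν : ℝ) * Complex.I - (∫ g, W g ^ 2 ∂ν : ℝ) / 2 : ℂ)
      = ∫ g, (1 + W g * Complex.I - W g ^ 2 / 2 : ℂ) ∂ν := by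
    rw [integral_sub .of_finite .of_finite, integral_add .of_finite .of_finite,
      integral_mul_const, integral_div, integral_const, ← integral_complex_ofReal,
      ← integral_complex_ofReal]
    simp
  rw [h, ← integral_sub .of_finite .of_finite, ← integral_const_mul]
  refine (norm_integral_le_integral_norm _).trans ?_
  exact integral_mono .of_finite .of_finite fun g => norm_exp_mul_I_sub_taylor_le hp2 hp3 _

/-- Lyapunov's central limit theorem for triangular arrays with i.i.d. rows, in terms of
characteristic functions: `R k` is the length of the `k`-th row, whose entries are distributed
as `W k`. -/
theorem tendsto_integral_exp_pow {G : ℕ → Type*} [∀ k, MeasurableSpace (G k)] [∀ k, Finite (G k)]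
    [∀ k, DiscreteMeasurableSpace (G k)] (ν : ∀ k, Measure (G k)) [∀ k, IsProbabilityMeasure (ν k)]
    (W : ∀ k, G k → ℝ) {R : ℕ → ℕ} (hR : Tendsto R atTop atTop) {p v C : ℝ} (hp2 : 2 < p)
    (hp3 : p ≤ 3) (hmean : Tendsto (fun k => √(R k : ℝ) * ∫ g, W k g ∂ν k) atTop (𝓝 0))
    (hvar : Tendsto (fun k => ∫ g, W k g ^ 2 ∂ν k) atTop (𝓝 v)) (hv : 0 ≤ v)
    (hmom : ∀ᶠ k in atTop, ∫ g, |W k g| ^ p ∂ν k ≤ C) :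
    Tendsto (fun k => (∫ g, Complex.exp (((√(R k : ℝ))⁻¹ * W k g : ℝ) * Complex.I) ∂ν k) ^ R k)
      atTop (𝓝 (Complex.exp (-(v / 2 : ℝ)))) := by
  have hRr : Tendsto (fun k => (R k : ℝ)) atTop atTop := tendsto_natCast_atTop_atTop.comp hR
  have hpos : ∀ᶠ k in atTop, 0 < (R k : ℝ) := hRr.eventually_gt_atTop 0
  set a : ℕ → ℂ := fun k => ∫ g, Complex.exp (((√(R k : ℝ))⁻¹ * W k g : ℝ) * Complex.I) ∂ν k
  -- An `R k`-th root of the limit, so that both sides are `R k`-th powers.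
  set b : ℕ → ℂ := fun k => Complex.exp (-(v / 2 / R k : ℝ))
  have ha : ∀ k, ‖a k‖ ≤ 1 := fun k => by
    refine (norm_integral_le_integral_norm _).trans ?_
    simp only [Complex.norm_exp_ofReal_mul_I]
    simp
  have hb : ∀ k, ‖b k‖ ≤ 1 := fun k => by
    rw [Complex.norm_exp]
    have : 0 ≤ v / 2 / R k := by positivity
    simpa [← Complex.ofReal_neg] using this
  have hbpow : ∀ᶠ k in atTop, b k ^ R k = Complex.exp (-(v / 2 : ℝ)) := by
    filter_upwards [hpos] with k hk
    rw [← Complex.exp_nat_mul]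
    congr 1
    push_cast
    have : (R k : ℂ) ≠ 0 := by exact_mod_cast hk.ne'
    field_simp
  -- The four errors, each already multiplied by `R k`: the Lyapunov remainder, the drift of the
  -- uncentred entries, the variance error, and the quadratic remainder of `exp` at `-(v / 2 / R
  -- k)`.
  have hbound : ∀ᶠ k in atTop, ‖a k ^ R k - Complex.exp (-(v / 2 : ℝ))‖ ≤
      4 * (C * (R k : ℝ) ^ (-(p / 2 - 1))) + |√(R k : ℝ) * ∫ g, W k g ∂ν k|
        + |∫ g, W k g ^ 2 ∂ν k - v| / 2 + (v / 2) ^ 2 / R k := by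
    filter_upwards [hpos, hbpow, hmom, hRr.eventually_ge_atTop (v / 2)] with k hk hbk hm hRv
    set r : ℝ := (R k : ℝ)
    have hsq : 0 < √r := Real.sqrt_pos.2 hk
    rw [← hbk]
    refine (norm_pow_sub_pow_le_of_norm_le_one (ha k) (hb k) _).trans ?_
    have h1 := norm_integral_exp_sub_taylor_le (ν k) (fun g => (√r)⁻¹ * W k g) hp2.le hp3
    have e1 : ∫ g, (√r)⁻¹ * W k g ∂ν k = (√r)⁻¹ * ∫ g, W k g ∂ν k := integral_const_mul _ _
    have e2 : ∫ g, ((√r)⁻¹ * W k g) ^ 2 ∂ν k = r⁻¹ * ∫ g, W k g ^ 2 ∂ν k := by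
      simp_rw [mul_pow, inv_pow, Real.sq_sqrt hk.le]
      exact integral_const_mul _ _
    have e3 : ∫ g, |(√r)⁻¹ * W k g| ^ p ∂ν k = r ^ (-(p / 2)) * ∫ g, |W k g| ^ p ∂ν k := by
      rw [← integral_const_mul]
      congr with g
      rw [abs_mul, Real.mul_rpow (abs_nonneg _) (abs_nonneg _), abs_of_pos (inv_pos.2 hsq),
        Real.sqrt_eq_rpow, ← Real.rpow_neg hk.le, ← Real.rpow_mul hk.le]
      congr 2; ring
    rw [e1, e2, e3] at h1
    set A := ∫ g, W k g ∂ν k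
    set V := ∫ g, W k g ^ 2 ∂ν k
    have h2 : ‖b k - (1 - (v / 2 / r : ℝ))‖ ≤ (v / 2 / r) ^ 2 := by
      have h := Complex.norm_exp_sub_one_sub_id_le (x := -(v / 2 / r : ℝ)) (by
        rw [norm_neg, Complex.norm_real, Real.norm_of_nonneg (by positivity)]
        exact (div_le_one hk).2 hRv)
      rw [norm_neg, Complex.norm_real, Real.norm_eq_abs, sq_abs] at h
      convert h using 2
      simp only [b]; ring
    have h3 : ‖((√r)⁻¹ * A : ℝ) * Complex.I - ((r⁻¹ * V : ℝ) / 2 - (v / 2 / r : ℝ) : ℂ)‖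
        ≤ (√r)⁻¹ * |A| + r⁻¹ * (|V - v| / 2) := by
      refine (norm_sub_le _ _).trans (add_le_add ?_ ?_)
      · simp [abs_of_pos hsq]
      · have : ((r⁻¹ * V : ℝ) / 2 - (v / 2 / r : ℝ) : ℂ) = ((r⁻¹ * ((V - v) / 2) : ℝ) : ℂ) := by
          push_cast; ring
        rw [this, Complex.norm_real, Real.norm_eq_abs, abs_mul, abs_of_pos (inv_pos.2 hk), abs_div,
          abs_two]
    have h4 : ‖a k - b k‖ ≤ 4 * (r ^ (-(p / 2)) * C) + ((√r)⁻¹ * |A| + r⁻¹ * (|V - v| / 2))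
        + (v / 2 / r) ^ 2 := by
      have : a k - b k = (a k - (1 + ((√r)⁻¹ * A : ℝ) * Complex.I - (r⁻¹ * V : ℝ) / 2))
          + (((√r)⁻¹ * A : ℝ) * Complex.I - ((r⁻¹ * V : ℝ) / 2 - (v / 2 / r : ℝ) : ℂ))
          - (b k - (1 - (v / 2 / r : ℝ))) := by ring
      rw [this]
      refine (norm_sub_le _ _).trans (add_le_add ((norm_add_le _ _).trans (add_le_add ?_ h3)) h2)
      exact h1.trans (by gcongr)
    refine (mul_le_mul_of_nonneg_left h4 hk.le).trans (le_of_eq ?_)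
    calc _ = 4 * (C * (r * r ^ (-(p / 2)))) + (r * (√r)⁻¹) * |A| + (r * r⁻¹) * (|V - v| / 2)
          + (v / 2) ^ 2 * (r / r ^ 2) := by ring
      _ = _ := by
        rw [mul_inv_cancel₀ hk.ne', abs_mul, abs_of_pos hsq]
        have e4 : r * r ^ (-(p / 2)) = r ^ (-(p / 2 - 1)) := by
          rw [show -(p / 2 - 1) = 1 + -(p / 2) by ring, Real.rpow_add hk, Real.rpow_one]
        have e5 : r * (√r)⁻¹ = √r := by
          rw [← div_eq_mul_inv, Real.div_sqrt]
        rw [e4, e5]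
        field_simp
  rw [tendsto_iff_norm_sub_tendsto_zero]
  refine squeeze_zero' (Eventually.of_forall fun _ => norm_nonneg _) hbound ?_
  have t1 : Tendsto (fun k => 4 * (C * (R k : ℝ) ^ (-(p / 2 - 1)))) atTop (𝓝 (4 * (C * 0))) :=
    (((tendsto_rpow_neg_atTop (by linarith : 0 < p / 2 - 1)).comp hRr).const_mul C).const_mul 4
  have t2 := hmean.abs
  have t3 : Tendsto (fun k => |∫ g, W k g ^ 2 ∂ν k - v| / 2) atTop (𝓝 (|v - v| / 2)) :=
    ((hvar.sub_const v).abs).div_const 2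
  have t4 : Tendsto (fun k => (v / 2) ^ 2 / (R k : ℝ)) atTop (𝓝 0) := hRr.const_div_atTop _
  simpa using ((t1.add t2).add t3).add t4

/-- The characteristic function of a sum of i.i.d. variables on the product space. -/
lemma integral_pi_exp_sum {G : Type*} [MeasurableSpace G] (ν : Measure G) [IsProbabilityMeasure ν]
    (W : G → ℝ) (N : ℕ) :
    ∫ π : Fin N → G, Complex.exp ((∑ r, W (π r) : ℝ) * Complex.I) ∂(Measure.pi fun _ => ν)
      = (∫ g, Complex.exp (W g * Complex.I) ∂ν) ^ N := by
  have := integral_fintype_prod_eq_pow (ι := Fin N) (μ := ν)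
    (fun g => Complex.exp (W g * Complex.I))
  rw [Fintype.card_fin] at this
  rw [← this]
  congr with π
  rw [← Complex.exp_sum, Complex.ofReal_sum, Finset.sum_mul]

/-- Lévy's continuity theorem is applied on `EuclideanSpace`, where the dot product is the inner
product; the result is carried back along the homeomorphism `WithLp.ofLp`. -/
lemma tendsto_stdNormal_of_tendsto_integral_exp {m : ℕ} (μ : ℕ → ProbabilityMeasure (Fin m → ℝ))
    (h : ∀ t : Fin m → ℝ,
      Tendsto (fun k => ∫ z, Complex.exp ((dotProduct t z : ℝ) * Complex.I) ∂(μ k : Measure _))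
        atTop (𝓝 (Complex.exp (-(dotProduct t t / 2 : ℝ))))) :
    Tendsto μ atTop (𝓝 (⟨stdNormal m, inferInstance⟩ : ProbabilityMeasure (Fin m → ℝ))) := by
  have hc : Continuous (WithLp.toLp 2 : (Fin m → ℝ) → EuclideanSpace ℝ (Fin m)) := by fun_prop
  have hc' : Continuous (WithLp.ofLp : EuclideanSpace ℝ (Fin m) → (Fin m → ℝ)) := by fun_prop
  have hE : Tendsto (fun k => (μ k).map hc.measurable.aemeasurable) atTop
      (𝓝 (ProbabilityMeasure.map ⟨stdNormal m, inferInstance⟩ hc.measurable.aemeasurable)) := by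
    refine ProbabilityMeasure.tendsto_of_tendsto_charFun fun t => ?_
    have hlim : charFun ((stdNormal m).map (WithLp.toLp 2)) t
        = Complex.exp (-(dotProduct (WithLp.ofLp t) (WithLp.ofLp t) / 2 : ℝ)) := by
      rw [stdNormal, map_pi_eq_stdGaussian, charFun_stdGaussian, ← Complex.ofReal_pow,
        EuclideanSpace.real_norm_sq_eq]
      simp [dotProduct, sq, neg_div]
    have := h (WithLp.ofLp t)
    rw [← hlim] at this
    refine this.congr fun k => ?_
    rw [charFun_apply]
    simp only [ProbabilityMeasure.toMeasure_map]
    rw [integral_map hc.measurable.aemeasurable (Measurable.aestronglyMeasurable (by fun_prop))]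
    rfl
  have := ProbabilityMeasure.tendsto_map_of_tendsto_of_continuous _ _ hE hc'
  have key : ∀ ν : ProbabilityMeasure (Fin m → ℝ),
      (ν.map hc.measurable.aemeasurable).map hc'.measurable.aemeasurable = ν := fun ν => by
    apply Subtype.ext
    simp only [ProbabilityMeasure.toMeasure_map, ProbabilityMeasure.val_eq_to_measure]
    rw [Measure.map_map hc'.measurable hc.measurable]
    exact Measure.map_id
  rw [key ⟨stdNormal m, inferInstance⟩] at this
  exact this.congr fun k => key (μ k)

lemma tendsto_gaussianReal_of_tendsto_integral_exp (μ : ℕ → ProbabilityMeasure ℝ)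
    (h : ∀ s : ℝ, Tendsto (fun k => ∫ z, Complex.exp ((s * z : ℝ) * Complex.I) ∂(μ k : Measure _))
        atTop (𝓝 (Complex.exp (-(s ^ 2 / 2 : ℝ))))) :
    Tendsto μ atTop (𝓝 (⟨gaussianReal 0 1, inferInstance⟩ : ProbabilityMeasure ℝ)) := by
  refine ProbabilityMeasure.tendsto_of_tendsto_charFun fun s => ?_
  have hlim : charFun (gaussianReal 0 1) s = Complex.exp (-(s ^ 2 / 2 : ℝ)) := by
    rw [charFun_gaussianReal]; simp
  have := h s
  rw [← hlim] at this
  refine this.congr fun k => ?_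
  rw [charFun_apply_real]
  simp

end CentralLimit

/-! ### Null boundaries, absence of atoms, and Pólya's theorem -/

section DistributionFunctions

lemma gaussianReal_singleton (c : ℝ) : gaussianReal 0 1 {c} = 0 := by
  have := nullSingletonClass_gaussianReal (μ := 0) (one_ne_zero : (1 : NNReal) ≠ 0)
  exact measure_singleton c

lemma stdNormal_eval_eq {m : ℕ} (i : Fin m) (c : ℝ) : stdNormal m {z | z i = c} = 0 := by
  have h := (measurePreserving_eval (fun _ : Fin m => gaussianReal 0 1) i).measure_preimage
    (measurableSet_singleton c).nullMeasurableSet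
  rw [gaussianReal_singleton] at h
  exact h

lemma stdNormal_frontier_Iic {m : ℕ} (t : Fin m → ℝ) : stdNormal m (frontier (Set.Iic t)) = 0 := by
  refine measure_mono_null (t := ⋃ i, {z : Fin m → ℝ | z i = t i}) ?_
    (measure_iUnion_null fun i => stdNormal_eval_eq i (t i))
  intro z hz
  rw [isClosed_Iic.frontier_eq] at hz
  by_contra hne
  simp only [Set.mem_iUnion, Set.mem_ofPred_eq, not_exists] at hne
  refine hz.2 (mem_interior.2 ⟨Set.univ.pi fun i => Set.Iio (t i), fun y hy i => ?_,
    isOpen_set_pi Set.finite_univ fun i _ => isOpen_Iio, fun i _ => ?_⟩)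
  · exact (hy i (Set.mem_univ i)).le
  · exact lt_of_le_of_ne (hz.1 i) (hne i)

/-- By Fubini: once all coordinates but the first are fixed, the first can only be one of two square
roots. For `m = 0` the law is a point mass at 0. -/
lemma chiSquare_singleton {m : ℕ} (hm : 0 < m) (c : ℝ) : chiSquare m {c} = 0 := by
  obtain ⟨m, rfl⟩ := Nat.exists_eq_succ_of_ne_zero hm.ne'
  have hmeas : Measurable fun z : Fin (m + 1) → ℝ => ∑ i, z i ^ 2 := by fun_prop
  rw [chiSquare, Measure.map_apply hmeas (measurableSet_singleton c), stdNormal]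
  have hpres := (measurePreserving_piFinSuccAbove
    (fun _ : Fin (m + 1) => gaussianReal 0 1) 0).symm
  have hs : MeasurableSet ((fun z : Fin (m + 1) → ℝ => ∑ i, z i ^ 2) ⁻¹' {c}) :=
    hmeas (measurableSet_singleton c)
  rw [← hpres.measure_preimage hs.nullMeasurableSet, ← Measure.prod_swap,
    Measure.map_apply measurable_swap (hpres.measurable hs),
    Measure.measure_prod_null (measurable_swap (hpres.measurable hs))]
  refine Eventually.of_forall fun y => ?_
  refine measure_mono_null (t := {√(c - ∑ i, y i ^ 2), -√(c - ∑ i, y i ^ 2)}) ?_ ?_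
  · intro x hx
    have hx' : x ^ 2 + ∑ i, y i ^ 2 = c := by
      simpa [Fin.sum_univ_succ, MeasurableEquiv.piFinSuccAbove] using hx
    have : √(c - ∑ i, y i ^ 2) = |x| := by
      rw [← hx', add_sub_cancel_right, Real.sqrt_sq_eq_abs]
    rw [this]
    rcases abs_cases x with h | h
    · left; exact h.1.symm
    · right; rw [Set.mem_singleton_iff, h.1, neg_neg]
  · exact measure_union_null (gaussianReal_singleton _) (gaussianReal_singleton _)

lemma continuous_cdf {ν : Measure ℝ} [IsProbabilityMeasure ν] (hν : ∀ c, ν {c} = 0) :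
    Continuous (cdf ν) := by
  rw [continuous_iff_continuousAt]
  intro c
  rw [(monotone_cdf ν).continuousAt_iff_leftLim_eq_rightLim, StieltjesFunction.rightLim_eq]
  have h := (cdf ν).measure_singleton c
  rw [measure_cdf, hν, eq_comm, ENNReal.ofReal_eq_zero] at h
  exact le_antisymm ((monotone_cdf ν).leftLim_le le_rfl) (by linarith)

/-- **Pólya's theorem**: weak convergence to a law without atoms implies uniform convergence of the
distribution functions. -/
theorem tendsto_iSup_abs_sub_cdf {μ : ℕ → ProbabilityMeasure ℝ} {ν : Measure ℝ}
    [IsProbabilityMeasure ν] (hν : ∀ c, ν {c} = 0)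
    (h : Tendsto μ atTop (𝓝 (⟨ν, inferInstance⟩ : ProbabilityMeasure ℝ))) :
    Tendsto (fun k => ⨆ t : ℝ, |(μ k : Measure ℝ).real (Set.Iic t) - ν.real (Set.Iic t)|)
      atTop (𝓝 0) := by
  have hpt : ∀ t, Tendsto (fun k => (μ k : Measure ℝ).real (Set.Iic t)) atTop
      (𝓝 (ν.real (Set.Iic t))) := fun t => by
    have := ProbabilityMeasure.tendsto_measure_of_null_frontier_of_tendsto' h (E := Set.Iic t)
      (by rw [frontier_Iic]; exact hν t)
    exact (ENNReal.tendsto_toReal (measure_ne_top _ _)).comp this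
  have hcont := continuous_cdf hν
  rw [Metric.tendsto_atTop]
  intro ε hε
  obtain ⟨N, hN⟩ := exists_nat_gt (4 / ε)
  have hNpos : (0 : ℝ) < N := lt_trans (by positivity) hN
  have hNε : 2 / (N : ℝ) < ε / 2 := by
    rw [div_lt_iff₀ hNpos]; rw [div_lt_iff₀ hε] at hN; linarith
  -- Quantiles from the intermediate value theorem. The levels 0 and 1 are left out, since they need
  -- not be attained.
  have hgrid : ∀ j : ℕ, ∃ s : ℝ, 0 < j → j < N → ν.real (Set.Iic s) = j / N := by
    intro j
    by_cases hj : 0 < j ∧ j < N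
    · have h0 : (0 : ℝ) < j / N := div_pos (by exact_mod_cast hj.1) hNpos
      have h1 : (j : ℝ) / N < 1 := (div_lt_one hNpos).2 (by exact_mod_cast hj.2)
      obtain ⟨s, hs⟩ := mem_range_of_exists_le_of_exists_ge hcont
        (((tendsto_cdf_atBot ν).eventually_le_const h0).exists)
        (((tendsto_cdf_atTop ν).eventually_const_le h1).exists)
      exact ⟨s, fun _ _ => by rw [← cdf_eq_real, hs]⟩
    · exact ⟨0, fun h1 h2 => absurd ⟨h1, h2⟩ hj⟩
  choose s hs using hgrid
  have hev : ∀ᶠ k in atTop, ∀ j ∈ Finset.range N,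
      |(μ k : Measure ℝ).real (Set.Iic (s j)) - ν.real (Set.Iic (s j))| < ε / 4 :=
    (Finset.eventually_all _).2 fun j _ => by
      have := (Metric.tendsto_nhds.1 (hpt (s j))) (ε / 4) (by positivity)
      simpa [Real.dist_eq] using this
  obtain ⟨K, hK⟩ := eventually_atTop.1 hev
  refine ⟨K, fun k hk => ?_⟩
  have hmono : ∀ (ρ : Measure ℝ) [IsProbabilityMeasure ρ] {a b : ℝ}, a ≤ b →
      ρ.real (Set.Iic a) ≤ ρ.real (Set.Iic b) := fun ρ _ a b hab =>
    measureReal_mono (Set.Iic_subset_Iic.2 hab)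
  have hlt : ∀ {a b : ℝ}, ν.real (Set.Iic a) < ν.real (Set.Iic b) → a ≤ b := fun {a b} hab => by
    by_contra hcon
    exact absurd (hmono ν (not_le.1 hcon).le) (not_le.2 hab)
  have hbound : ∀ t, |(μ k : Measure ℝ).real (Set.Iic t) - ν.real (Set.Iic t)|
      ≤ 2 / N + ε / 4 := by
    intro t
    set F := ν.real (Set.Iic t) with hF
    have hF0 : 0 ≤ F := measureReal_nonneg
    have hF1 : F ≤ 1 := measureReal_le_one
    have hG0 : 0 ≤ (μ k : Measure ℝ).real (Set.Iic t) := measureReal_nonneg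
    have hG1 : (μ k : Measure ℝ).real (Set.Iic t) ≤ 1 := measureReal_le_one
    -- Below `t` the quantile of index `j - 1` is used rather than `j`, so that its level is
    -- strictly less than `F` and `hlt` places it left of `t`; this costs `2 / N`. Near the ends,
    -- where no quantile is available, `F` is within `2 / N` of 0 or within `1 / N` of 1.
    set j := ⌊N * F⌋₊
    have hj1 : (j : ℝ) ≤ N * F := Nat.floor_le (by positivity)
    have hj2 : N * F < j + 1 := Nat.lt_floor_add_one _
    have hinv : 0 < 1 / (N : ℝ) := by positivity
    have h2N : 2 / (N : ℝ) = 1 / N + 1 / N := by ring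
    rw [abs_le]
    constructor
    · rcases le_or_gt j 1 with hj | hj
      · have : F ≤ 2 / N := by
          rw [le_div_iff₀ hNpos]
          have : (j : ℝ) ≤ 1 := by exact_mod_cast hj
          nlinarith
        linarith
      · obtain ⟨i, hi⟩ : ∃ i, j = i + 1 := ⟨j - 1, by omega⟩
        have hiN : i < N := by
          have : (j : ℝ) ≤ N := hj1.trans (by nlinarith)
          have : j ≤ N := by exact_mod_cast this
          omega
        have hsi := hs i (by omega) hiN
        have hij : (j : ℝ) = i + 1 := by exact_mod_cast hi
        have hst : s i ≤ t := hlt (by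
          rw [hsi, ← hF, div_lt_iff₀ hNpos]; linarith)
        have hG := hmono (μ k : Measure ℝ) hst
        have hk' := abs_lt.1 (hK k hk i (Finset.mem_range.2 hiN))
        rw [hsi] at hk'
        have : F ≤ i / N + 2 / N := by
          rw [← add_div, le_div_iff₀ hNpos]; linarith
        linarith [hk'.1]
    · rcases le_or_gt N (j + 1) with hj | hj
      · have : 1 - 1 / N ≤ F := by
          have h1 : (N : ℝ) ≤ j + 1 := by exact_mod_cast hj
          rw [sub_le_iff_le_add, ← sub_le_iff_le_add', le_div_iff₀ hNpos]; nlinarith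
        linarith
      · have hsj := hs (j + 1) (by omega) hj
        have hst : t ≤ s (j + 1) := hlt (by
          rw [hsj, ← hF, lt_div_iff₀ hNpos]; push_cast; linarith)
        have hG := hmono (μ k : Measure ℝ) hst
        have hk' := abs_lt.1 (hK k hk (j + 1) (Finset.mem_range.2 hj))
        rw [hsj] at hk'
        have : ((j + 1 : ℕ) : ℝ) / N ≤ F + 1 / N := by
          rw [div_le_iff₀ hNpos]
          have : (F + 1 / N) * (N : ℝ) = N * F + 1 := by field_simp
          push_cast; linarith
        linarith [hk'.2]
  rw [Real.dist_eq, sub_zero, abs_of_nonneg (Real.iSup_nonneg fun t => abs_nonneg _)]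
  exact lt_of_le_of_lt (ciSup_le hbound) (by linarith)

end DistributionFunctions

/-! ### Averages over uniform random permutations -/

section PermutationAverages

open Equiv

instance isProbabilityMeasure_uniformOn_perm (n : ℕ) :
    IsProbabilityMeasure (uniformOn (Set.univ : Set (Perm (Fin n)))) :=
  isProbabilityMeasure_uniformOn Set.finite_univ Set.univ_nonempty

lemma integral_uniformOn_univ {G : Type*} [Fintype G] [MeasurableSpace G]
    [DiscreteMeasurableSpace G] (f : G → ℝ) :
    ∫ g, f g ∂(uniformOn (Set.univ : Set G)) = (Fintype.card G : ℝ)⁻¹ * ∑ g, f g := by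
  have hfin : IsFiniteMeasure (uniformOn (Set.univ : Set G)) := by
    unfold uniformOn; infer_instance
  rw [integral_fintype .of_finite, Finset.mul_sum]
  refine Finset.sum_congr rfl fun g _ => ?_
  simp [measureReal_def, uniformOn_univ]

variable {n : ℕ}

/-- Composition with a transposition shows that the sum over permutations does not depend on `a`;
summing over all `a` and exchanging sums gives the value. -/
lemma card_mul_sum_perm_apply (f : Fin n → ℝ) (a : Fin n) :
    (n : ℝ) * ∑ σ : Perm (Fin n), f (σ a) = (Fintype.card (Perm (Fin n)) : ℝ) * ∑ i, f i := by
  have h : ∀ b, ∑ σ : Perm (Fin n), f (σ b) = ∑ σ : Perm (Fin n), f (σ a) := fun b => by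
    rw [← Equiv.sum_comp (Equiv.mulRight (swap a b))]
    simp
  calc (n : ℝ) * ∑ σ : Perm (Fin n), f (σ a) = ∑ b, ∑ σ : Perm (Fin n), f (σ b) := by
        simp_rw [h]; simp
    _ = ∑ σ : Perm (Fin n), ∑ b, f (σ b) := Finset.sum_comm
    _ = _ := by simp_rw [Equiv.sum_comp]; simp

lemma exists_perm_apply_eq {α : Type*} [DecidableEq α] {a b a' b' : α} (h : a ≠ b)
    (h' : a' ≠ b') : ∃ τ : Perm α, τ a = a' ∧ τ b = b' := by
  refine ⟨swap (swap a a' b) b' * swap a a', ?_, by simp⟩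
  rw [Perm.mul_apply, swap_apply_left]
  refine swap_apply_of_ne_of_ne (fun hc => h ?_) h'
  exact (swap a a').injective (by rw [swap_apply_left, ← hc])

/-- The same double count over ordered pairs of distinct indices, which the symmetric group permutes
transitively. The diagonal is subtracted because the two draws are without replacement. -/
lemma card_mul_sum_perm_apply_pair (g : Fin n → Fin n → ℝ) {a b : Fin n} (hab : a ≠ b) :
    ((n : ℝ) * (n - 1)) * ∑ σ : Perm (Fin n), g (σ a) (σ b)
      = (Fintype.card (Perm (Fin n)) : ℝ) * (∑ i, ∑ j, g i j - ∑ i, g i i) := by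
  have h : ∀ x ∈ (Finset.univ : Finset (Fin n)).offDiag,
      ∑ σ : Perm (Fin n), g (σ x.1) (σ x.2) = ∑ σ : Perm (Fin n), g (σ a) (σ b) := fun x hx => by
    obtain ⟨τ, h1, h2⟩ := exists_perm_apply_eq hab (Finset.mem_offDiag.1 hx).2.2
    rw [← Equiv.sum_comp (Equiv.mulRight τ) fun σ => g (σ a) (σ b)]
    simp [h1, h2]
  have hoff : ∀ F : Fin n → Fin n → ℝ, ∑ x ∈ (Finset.univ : Finset (Fin n)).offDiag, F x.1 x.2
      = ∑ i, ∑ j, F i j - ∑ i, F i i := fun F => by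
    have := Finset.sum_union (Finset.disjoint_diag_offDiag (Finset.univ : Finset (Fin n)))
      (f := fun x => F x.1 x.2)
    rw [Finset.diag_union_offDiag, Finset.sum_product, Finset.sum_diag] at this
    linarith
  calc ((n : ℝ) * (n - 1)) * ∑ σ : Perm (Fin n), g (σ a) (σ b)
      = ∑ x ∈ (Finset.univ : Finset (Fin n)).offDiag,
          ∑ σ : Perm (Fin n), g (σ x.1) (σ x.2) := by
        rw [Finset.sum_congr rfl h, Finset.sum_const, Finset.offDiag_card]
        simp [Nat.cast_sub (Nat.le_mul_self n)]
        left; ring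
    _ = ∑ σ : Perm (Fin n), ∑ x ∈ (Finset.univ : Finset (Fin n)).offDiag,
          g (σ x.1) (σ x.2) := Finset.sum_comm
    _ = ∑ _σ : Perm (Fin n), (∑ i, ∑ j, g i j - ∑ i, g i i) := by
        refine Finset.sum_congr rfl fun σ _ => ?_
        rw [hoff fun i j => g (σ i) (σ j), Equiv.sum_comp σ fun i => ∑ j, g i (σ j),
          Equiv.sum_comp σ fun i => g i i]
        congr 1
        exact Finset.sum_congr rfl fun i _ => Equiv.sum_comp σ (g i)
    _ = _ := by rw [Finset.sum_const, nsmul_eq_mul, Finset.card_univ]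

variable {m : ℕ}

lemma integral_drawn_zero (hn : 0 < n) (z : Fin n → Fin m → ℝ) (f : (Fin m → ℝ) → ℝ) :
    ∫ σ, f (drawn z σ 0) ∂(uniformOn (Set.univ : Set (Perm (Fin n))))
      = (n : ℝ)⁻¹ * ∑ i, f (z i) := by
  have hn' : (n : ℝ) ≠ 0 := by exact_mod_cast hn.ne'
  have hc : (Fintype.card (Perm (Fin n)) : ℝ) ≠ 0 := by exact_mod_cast Fintype.card_ne_zero
  have h := card_mul_sum_perm_apply (fun i => f (z i)) ⟨0, hn⟩
  rw [integral_uniformOn_univ]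
  simp only [drawn, hn, dite_true]
  field_simp
  linarith

lemma integral_drawn_zero_one (hn : 1 < n) (z : Fin n → Fin m → ℝ)
    (g : (Fin m → ℝ) → (Fin m → ℝ) → ℝ) :
    ∫ σ, g (drawn z σ 0) (drawn z σ 1) ∂(uniformOn (Set.univ : Set (Perm (Fin n))))
      = ((n : ℝ) * (n - 1))⁻¹ * (∑ i, ∑ j, g (z i) (z j) - ∑ i, g (z i) (z i)) := by
  have hn1 : (1 : ℝ) < n := by exact_mod_cast hn
  have hn' : (n : ℝ) ≠ 0 := by positivity
  have hn2 : (n : ℝ) - 1 ≠ 0 := by linarith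
  have hc : (Fintype.card (Perm (Fin n)) : ℝ) ≠ 0 := by exact_mod_cast Fintype.card_ne_zero
  have h := card_mul_sum_perm_apply_pair (fun i j => g (z i) (z j))
    (a := ⟨0, by omega⟩) (b := ⟨1, hn⟩) (by simp)
  rw [integral_uniformOn_univ]
  simp only [drawn, hn, (by omega : 0 < n), dite_true]
  field_simp
  linarith

end PermutationAverages

/-! ### Moment identities for standardized points -/

section Standardized

variable {n m : ℕ}

lemma abs_dotProduct_le (u v : Fin m → ℝ) :
    |dotProduct u v| ≤ √(dotProduct u u) * √(dotProduct v v) := by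
  rw [← Real.sqrt_mul_self_eq_abs, ← Real.sqrt_mul (by simp [dotProduct, Finset.sum_nonneg,
    mul_self_nonneg])]
  refine Real.sqrt_le_sqrt ?_
  have := Finset.sum_mul_sq_le_sq_mul_sq Finset.univ u v
  simpa [dotProduct, sq] using this

lemma dotProduct_self_nonneg' (u : Fin m → ℝ) : 0 ≤ dotProduct u u :=
  Finset.sum_nonneg fun _ _ => mul_self_nonneg _

/-- The points `z` have mean `d` and covariance matrix `I`; the `p`-th absolute sample moment is
at most `C`, and the squared length of the mean at most `C / n`. -/
structure IsStandardized (z : Fin n → Fin m → ℝ) (d : Fin m → ℝ) (p C : ℝ) : Prop where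
  mean : ∀ j, ∑ i, z i j = n * d j
  second : ∀ j l, ∑ i, z i j * z i l = n * ((1 : Matrix (Fin m) (Fin m) ℝ) j l + d j * d l)
  moment : ∑ i, √(dotProduct (z i) (z i)) ^ p ≤ n * C
  mean_sq : n * dotProduct d d ≤ C

namespace IsStandardized

variable {z : Fin n → Fin m → ℝ} {d : Fin m → ℝ} {p C : ℝ}

lemma sum_dotProduct (h : IsStandardized z d p C) (t : Fin m → ℝ) :
    ∑ i, dotProduct t (z i) = n * dotProduct t d := by
  simp only [dotProduct]
  rw [Finset.sum_comm, Finset.mul_sum]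
  refine Finset.sum_congr rfl fun j _ => ?_
  rw [← Finset.mul_sum, h.mean]; ring

lemma sum_dotProduct_sq (h : IsStandardized z d p C) (t : Fin m → ℝ) :
    ∑ i, dotProduct t (z i) ^ 2 = n * (dotProduct t t + dotProduct t d ^ 2) := by
  have e : ∀ i, dotProduct t (z i) ^ 2 = ∑ j, ∑ l, t j * t l * (z i j * z i l) := fun i => by
    rw [sq]; simp only [dotProduct]; rw [Finset.sum_mul_sum]
    exact Finset.sum_congr rfl fun j _ => Finset.sum_congr rfl fun l _ => by ring
  have e' : dotProduct t d ^ 2 = ∑ j, ∑ l, t j * t l * (d j * d l) := by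
    rw [sq]; simp only [dotProduct]; rw [Finset.sum_mul_sum]
    exact Finset.sum_congr rfl fun j _ => Finset.sum_congr rfl fun l _ => by ring
  have e'' : dotProduct t t
      = ∑ j, ∑ l, t j * t l * (1 : Matrix (Fin m) (Fin m) ℝ) j l := by
    simp [dotProduct, Matrix.one_apply]
  simp_rw [e]
  rw [Finset.sum_comm, e', e'', ← Finset.sum_add_distrib, Finset.mul_sum]
  refine Finset.sum_congr rfl fun j _ => ?_
  rw [Finset.sum_comm, ← Finset.sum_add_distrib, Finset.mul_sum]
  refine Finset.sum_congr rfl fun l _ => ?_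
  rw [← Finset.mul_sum, h.second]; ring

lemma sum_self (h : IsStandardized z d p C) :
    ∑ i, dotProduct (z i) (z i) = n * (m + dotProduct d d) := by
  simp only [dotProduct]
  rw [Finset.sum_comm]
  simp_rw [h.second]
  rw [← Finset.mul_sum, Finset.sum_add_distrib]
  simp

lemma sum_sum_dotProduct (h : IsStandardized z d p C) :
    ∑ i, ∑ j, dotProduct (z i) (z j) = n ^ 2 * dotProduct d d := by
  simp_rw [h.sum_dotProduct, dotProduct_comm _ d]
  rw [← Finset.mul_sum, h.sum_dotProduct]; ring

lemma sum_sum_dotProduct_sq (h : IsStandardized z d p C) :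
    ∑ i, ∑ j, dotProduct (z i) (z j) ^ 2
      = n ^ 2 * (m + 2 * dotProduct d d + dotProduct d d ^ 2) := by
  simp_rw [h.sum_dotProduct_sq, dotProduct_comm _ d]
  rw [← Finset.mul_sum, Finset.sum_add_distrib, h.sum_self, h.sum_dotProduct_sq]; ring

lemma const_nonneg (h : IsStandardized z d p C) : 0 ≤ C :=
  (mul_nonneg (Nat.cast_nonneg n) (dotProduct_self_nonneg' d)).trans h.mean_sq

/-- With `a i = |z i|^p`, the fourth powers are `a i ^ (4 / p)`; one factor `a i` is summed and the
rest is bounded by the total. As `4 / p < 2`, the result is `o(n^2)`, although no fourth moment is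
assumed. -/
lemma sum_self_sq_le (h : IsStandardized z d p C) (hp2 : 2 < p) (hp3 : p ≤ 3) :
    ∑ i, dotProduct (z i) (z i) ^ 2 ≤ (n * C) ^ (4 / p) := by
  have hC := h.const_nonneg
  set a : Fin n → ℝ := fun i => √(dotProduct (z i) (z i)) ^ p
  have ha : ∀ i, 0 ≤ a i := fun i => by positivity
  have hp : 0 < p := by linarith
  have hle : ∀ i, a i ≤ n * C := fun i =>
    (Finset.single_le_sum (fun j _ => ha j) (Finset.mem_univ i)).trans h.moment
  have hnC : 0 ≤ (n : ℝ) * C := by positivity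
  have e1 : 1 < 4 / p := by rw [lt_div_iff₀ hp]; linarith
  have hterm : ∀ i, dotProduct (z i) (z i) ^ 2 ≤ a i * (n * C) ^ (4 / p - 1) := fun i => by
    have h0 := dotProduct_self_nonneg' (z i)
    have : dotProduct (z i) (z i) ^ 2 = a i ^ (1 + (4 / p - 1)) := by
      simp only [a]
      rw [← Real.rpow_mul (Real.sqrt_nonneg _), Real.sqrt_eq_rpow, ← Real.rpow_mul h0,
        ← Real.rpow_natCast _ 2]
      congr 1; field_simp; norm_num
    rw [this, Real.rpow_add_of_nonneg (ha i) zero_le_one (by linarith), Real.rpow_one]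
    have := ha i
    exact mul_le_mul_of_nonneg_left (Real.rpow_le_rpow this (hle i) (by linarith)) this
  calc ∑ i, dotProduct (z i) (z i) ^ 2 ≤ ∑ i, a i * (n * C) ^ (4 / p - 1) :=
        Finset.sum_le_sum fun i _ => hterm i
    _ ≤ (n * C) * (n * C) ^ (4 / p - 1) := by
        rw [← Finset.sum_mul]
        gcongr
        exact h.moment
    _ = (n * C) ^ (4 / p) := by
        conv_rhs => rw [show 4 / p = 1 + (4 / p - 1) by ring,
          Real.rpow_add_of_nonneg hnC zero_le_one (by linarith), Real.rpow_one]

end IsStandardized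

end Standardized

/-! ### Characteristic function limits for standardized points -/

section StandardizedLimits

open Equiv

/-- The law of `R` i.i.d. uniform permutations of `Fin n`. -/
def permLaw (n R : ℕ) : Measure (Fin R → Perm (Fin n)) :=
  Measure.pi fun _ => uniformOn Set.univ

instance isProbabilityMeasure_permLaw (n R : ℕ) : IsProbabilityMeasure (permLaw n R) := by
  unfold permLaw; infer_instance

variable {m : ℕ} {n R : ℕ → ℕ} {z : ∀ k, Fin (n k) → Fin m → ℝ} {d : ℕ → Fin m → ℝ} {p C : ℝ}

lemma tendsto_integral_exp_mean (hn : Tendsto n atTop atTop) (hR : Tendsto R atTop atTop)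
    (hRn : Tendsto (fun k => (R k : ℝ) / n k) atTop (𝓝 0)) (hp2 : 2 < p) (hp3 : p ≤ 3)
    (hz : ∀ᶠ k in atTop, IsStandardized (z k) (d k) p C) (t : Fin m → ℝ) :
    Tendsto (fun k => ∫ π, Complex.exp
        ((dotProduct t ((√(R k : ℝ))⁻¹ • ∑ r, drawn (z k) (π r) 0) : ℝ) * Complex.I)
          ∂(permLaw (n k) (R k))) atTop (𝓝 (Complex.exp (-(dotProduct t t / 2 : ℝ)))) := by
  have hnr : Tendsto (fun k => (n k : ℝ)) atTop atTop := tendsto_natCast_atTop_atTop.comp hn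
  set T := √(dotProduct t t)
  have htd : ∀ᶠ k in atTop, dotProduct t (d k) ^ 2 ≤ T ^ 2 * (C / n k) := by
    filter_upwards [hz, hn.eventually_gt_atTop 0] with k hk hnk
    have hnk' : (0 : ℝ) < n k := by exact_mod_cast hnk
    have h1 := abs_dotProduct_le t (d k)
    have h2 : dotProduct (d k) (d k) ≤ C / n k := by
      rw [le_div_iff₀ hnk', mul_comm]; exact hk.mean_sq
    calc dotProduct t (d k) ^ 2 = |dotProduct t (d k)| ^ 2 := (sq_abs _).symm
      _ ≤ (T * √(dotProduct (d k) (d k))) ^ 2 := by gcongr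
      _ = T ^ 2 * dotProduct (d k) (d k) := by
        rw [mul_pow, Real.sq_sqrt (dotProduct_self_nonneg' (d k))]
      _ ≤ _ := by gcongr
  have key := tendsto_integral_exp_pow (fun k => uniformOn (Set.univ : Set (Perm (Fin (n k)))))
    (fun k σ => dotProduct t (drawn (z k) σ 0)) hR (v := dotProduct t t) (C := T ^ p * C)
    hp2 hp3 ?_ ?_ (dotProduct_self_nonneg' t) ?_
  · refine key.congr fun k => ?_
    rw [permLaw, ← integral_pi_exp_sum]
    congr with π
    congr 3
    rw [dotProduct_smul, dotProduct_sum, smul_eq_mul, Finset.mul_sum]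
  -- The squared drift is `R (t·d)^2 ≤ T^2 C R / n`; this is where `R / n → 0` enters.
  · have hsq : Tendsto (fun k => √(T ^ 2 * C * ((R k : ℝ) / n k))) atTop (𝓝 0) := by
      simpa using (hRn.const_mul (T ^ 2 * C)).sqrt
    refine squeeze_zero_norm' ?_ hsq
    filter_upwards [hz, hn.eventually_gt_atTop 0, htd] with k hk hnk htk
    have hnk' : (0 : ℝ) < n k := by exact_mod_cast hnk
    rw [integral_drawn_zero hnk, hk.sum_dotProduct, inv_mul_cancel_left₀ hnk'.ne']
    refine Real.le_sqrt_of_sq_le ?_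
    rw [Real.norm_eq_abs, sq_abs, mul_pow, Real.sq_sqrt (Nat.cast_nonneg _)]
    calc (R k : ℝ) * dotProduct t (d k) ^ 2 ≤ R k * (T ^ 2 * (C / n k)) := by gcongr
      _ = _ := by ring
  · have h0 : Tendsto (fun k => dotProduct t (d k) ^ 2) atTop (𝓝 0) := by
      refine squeeze_zero' (Eventually.of_forall fun _ => sq_nonneg _) htd ?_
      simpa using (hnr.const_div_atTop C).const_mul (T ^ 2)
    have : Tendsto (fun k => dotProduct t t + dotProduct t (d k) ^ 2) atTop
        (𝓝 (dotProduct t t)) := by simpa using h0.const_add (dotProduct t t)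
    refine this.congr' ?_
    filter_upwards [hz, hn.eventually_gt_atTop 0] with k hk hnk
    have hnk' : (0 : ℝ) < n k := by exact_mod_cast hnk
    rw [integral_drawn_zero hnk _ fun u => dotProduct t u ^ 2, hk.sum_dotProduct_sq,
      inv_mul_cancel_left₀ hnk'.ne']
  · filter_upwards [hz, hn.eventually_gt_atTop 0] with k hk hnk
    have hnk' : (0 : ℝ) < n k := by exact_mod_cast hnk
    rw [integral_drawn_zero hnk _ fun u => |dotProduct t u| ^ p, inv_mul_le_iff₀ hnk']
    calc ∑ i, |dotProduct t (z k i)| ^ p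
        ≤ ∑ i, T ^ p * √(dotProduct (z k i) (z k i)) ^ p := by
          refine Finset.sum_le_sum fun i _ => ?_
          rw [← Real.mul_rpow (Real.sqrt_nonneg _) (Real.sqrt_nonneg _)]
          exact Real.rpow_le_rpow (abs_nonneg _) (abs_dotProduct_le _ _) (by linarith)
      _ ≤ T ^ p * (n k * C) := by
          rw [← Finset.mul_sum]
          gcongr
          exact hk.moment
      _ = _ := by ring

lemma tendsto_integral_exp_uStat (hm : 0 < m) (hn : Tendsto n atTop atTop)
    (hR : Tendsto R atTop atTop)
    (hRn : Tendsto (fun k => √(R k : ℝ) / n k) atTop (𝓝 0)) (hp2 : 2 < p) (hp3 : p ≤ 3)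
    (hz : ∀ᶠ k in atTop, IsStandardized (z k) (d k) p C) (s : ℝ) :
    Tendsto (fun k => ∫ π, Complex.exp
        ((s * ((√((m : ℝ) * R k))⁻¹ *
          ∑ r, dotProduct (drawn (z k) (π r) 0) (drawn (z k) (π r) 1)) : ℝ) * Complex.I)
          ∂(permLaw (n k) (R k))) atTop (𝓝 (Complex.exp (-(s ^ 2 / 2 : ℝ)))) := by
  have hnr : Tendsto (fun k => (n k : ℝ)) atTop atTop := tendsto_natCast_atTop_atTop.comp hn
  have hm' : (0 : ℝ) < m := by exact_mod_cast hm
  -- The second moment of the product of two draws tends to `m`, hence the scaling by `√m`.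
  obtain ⟨c, hc_def⟩ : ∃ c : ℝ, c = s * (√(m : ℝ))⁻¹ := ⟨_, rfl⟩
  have hc : c ^ 2 * m = s ^ 2 := by
    rw [hc_def, mul_pow, inv_pow, Real.sq_sqrt hm'.le]; field_simp
  have hev : ∀ᶠ k in atTop, IsStandardized (z k) (d k) p C ∧ 1 < n k := hz.and
    (hn.eventually_gt_atTop 1)
  have hC : 0 ≤ C := hz.exists.choose_spec.const_nonneg
  have hD : Tendsto (fun k => dotProduct (d k) (d k)) atTop (𝓝 0) := by
    refine squeeze_zero' (Eventually.of_forall fun _ => dotProduct_self_nonneg' _) ?_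
      (hnr.const_div_atTop C)
    filter_upwards [hev] with k ⟨hk, hnk⟩
    have hnk' : (0 : ℝ) < n k := by exact_mod_cast (by omega : 0 < n k)
    rw [le_div_iff₀ hnk', mul_comm]; exact hk.mean_sq
  have key := tendsto_integral_exp_pow (fun k => uniformOn (Set.univ : Set (Perm (Fin (n k)))))
    (fun k σ => c * dotProduct (drawn (z k) σ 0) (drawn (z k) σ 1)) hR (v := s ^ 2)
    (C := |c| ^ p * (2 * C ^ 2)) hp2 hp3 ?_ ?_ (sq_nonneg s) ?_
  · refine key.congr fun k => ?_
    rw [permLaw, ← integral_pi_exp_sum]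
    congr with π
    congr 3
    rw [Real.sqrt_mul hm'.le, mul_inv, Finset.mul_sum, Finset.mul_sum]
    refine Finset.sum_congr rfl fun r _ => ?_
    rw [hc_def]; ring
  -- Both the full double sum `n^2 |d|^2` and its diagonal `n (m + |d|^2)` are `O(n)`, because `n
  -- |d|^2 ≤ C`. Division by `n (n - 1)` leaves a mean of order `1 / n`.
  · have hsq : Tendsto (fun k => |c| * (2 * (2 * C + m)) * (√(R k : ℝ) / n k)) atTop (𝓝 0) := by
      simpa using hRn.const_mul (|c| * (2 * (2 * C + m)))
    refine squeeze_zero_norm' ?_ hsq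
    filter_upwards [hev] with k ⟨hk, hnk⟩
    have hnk' : (1 : ℝ) < n k := by exact_mod_cast hnk
    have hnk2 : (2 : ℝ) ≤ n k := by exact_mod_cast hnk
    rw [integral_const_mul, integral_drawn_zero_one hnk, hk.sum_sum_dotProduct, hk.sum_self]
    have hD0 := dotProduct_self_nonneg' (d k)
    have hDC := hk.mean_sq
    set N : ℝ := (n k : ℝ)
    set D := dotProduct (d k) (d k)
    have h1 : |N ^ 2 * D - N * (m + D)| ≤ N * (2 * C + m) := by
      rw [abs_le]; constructor <;> nlinarith
    have h2 : (N * (N - 1))⁻¹ ≤ 2 / N ^ 2 := by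
      rw [inv_eq_one_div, div_le_div_iff₀ (by nlinarith) (by positivity)]; nlinarith
    rw [Real.norm_eq_abs, abs_mul, abs_mul, abs_mul, abs_of_nonneg (Real.sqrt_nonneg _),
      abs_of_pos (inv_pos.2 (by nlinarith : 0 < N * (N - 1)))]
    calc √(R k : ℝ) * (|c| * ((N * (N - 1))⁻¹ * |N ^ 2 * D - N * (m + D)|))
        ≤ √(R k : ℝ) * (|c| * (2 / N ^ 2 * (N * (2 * C + m)))) := by gcongr
      _ = _ := by field_simp
  -- The diagonal part of the second moment is `O(n ^ (4 / p - 2))`.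
  · have hQ : Tendsto (fun k => ((n k : ℝ) * (n k - 1))⁻¹ *
        ∑ i, dotProduct (z k i) (z k i) ^ 2) atTop (𝓝 0) := by
      have hlim : Tendsto (fun k => 2 * C ^ (4 / p) * (n k : ℝ) ^ (-(2 - 4 / p))) atTop (𝓝 0) := by
        have : 0 < 2 - 4 / p := by
          rw [sub_pos, div_lt_iff₀ (by linarith)]; linarith
        simpa using ((tendsto_rpow_neg_atTop this).comp hnr).const_mul (2 * C ^ (4 / p))
      refine squeeze_zero' ?_ ?_ hlim
      · filter_upwards [hev] with k ⟨hk, hnk⟩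
        have hnk' : (1 : ℝ) < n k := by exact_mod_cast hnk
        have : (0 : ℝ) ≤ (n k : ℝ) - 1 := by linarith
        positivity
      · filter_upwards [hev] with k ⟨hk, hnk⟩
        have hnk' : (1 : ℝ) < n k := by exact_mod_cast hnk
        have hnk2 : (2 : ℝ) ≤ n k := by exact_mod_cast hnk
        have hle := hk.sum_self_sq_le hp2 hp3
        set N : ℝ := (n k : ℝ)
        have hN : 0 < N := by linarith
        have h2 : (N * (N - 1))⁻¹ ≤ 2 / N ^ 2 := by
          rw [inv_eq_one_div, div_le_div_iff₀ (by nlinarith) (by positivity)]; nlinarith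
        calc (N * (N - 1))⁻¹ * ∑ i, dotProduct (z k i) (z k i) ^ 2
            ≤ 2 / N ^ 2 * (N * C) ^ (4 / p) := by gcongr
          _ = _ := by
            rw [Real.mul_rpow hN.le hC, neg_sub, Real.rpow_sub hN, Real.rpow_two]
            ring
    have hrat : Tendsto (fun k => (n k : ℝ) / (n k - 1)) atTop (𝓝 1) := by
      have h1 : Tendsto (fun k => 1 + 1 / ((n k : ℝ) - 1)) atTop (𝓝 (1 + 0)) :=
        ((tendsto_atTop_add_const_right _ (-1) hnr).const_div_atTop 1).const_add 1
      rw [add_zero] at h1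
      refine h1.congr' ?_
      filter_upwards [hnr.eventually_gt_atTop 1] with k hk
      have : (n k : ℝ) - 1 ≠ 0 := by linarith
      field_simp; ring
    have hmain : Tendsto (fun k => c ^ 2 * ((n k : ℝ) / (n k - 1) *
        (m + 2 * dotProduct (d k) (d k) + dotProduct (d k) (d k) ^ 2)
          - ((n k : ℝ) * (n k - 1))⁻¹ * ∑ i, dotProduct (z k i) (z k i) ^ 2)) atTop
        (𝓝 (s ^ 2)) := by
      have := ((hrat.mul (((hD.const_mul 2).const_add (m : ℝ)).add (hD.pow 2))).sub hQ).const_mul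
        (c ^ 2)
      simpa [hc] using this
    refine hmain.congr' ?_
    filter_upwards [hev] with k ⟨hk, hnk⟩
    have hnk' : (1 : ℝ) < n k := by exact_mod_cast hnk
    have hnk2 : (n k : ℝ) - 1 ≠ 0 := by linarith
    simp_rw [mul_pow]
    rw [integral_const_mul, integral_drawn_zero_one hnk _ fun u v => dotProduct u v ^ 2,
      hk.sum_sum_dotProduct_sq]
    field_simp
  · filter_upwards [hev] with k ⟨hk, hnk⟩
    have hnk' : (1 : ℝ) < n k := by exact_mod_cast hnk
    have hnk2 : (2 : ℝ) ≤ n k := by exact_mod_cast hnk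
    simp_rw [abs_mul, Real.mul_rpow (abs_nonneg _) (abs_nonneg _)]
    rw [integral_const_mul, integral_drawn_zero_one hnk _ fun u v => |dotProduct u v| ^ p]
    have hmom := hk.moment
    set N : ℝ := (n k : ℝ)
    set a : Fin (n k) → ℝ := fun i => √(dotProduct (z k i) (z k i)) ^ p
    have ha : ∀ i, 0 ≤ a i := fun i => by positivity
    -- By Cauchy–Schwarz the moment of a product factors, so order `p` suffices for pairs too. The
    -- diagonal is then dropped, and `n / (n - 1) ≤ 2` accounts for the constant `2 * C ^ 2`.
    have hsum : ∑ i, ∑ j, |dotProduct (z k i) (z k j)| ^ p ≤ (N * C) ^ 2 := by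
      calc ∑ i, ∑ j, |dotProduct (z k i) (z k j)| ^ p ≤ ∑ i, ∑ j, a i * a j := by
            refine Finset.sum_le_sum fun i _ => Finset.sum_le_sum fun j _ => ?_
            simp only [a]
            rw [← Real.mul_rpow (Real.sqrt_nonneg _) (Real.sqrt_nonneg _)]
            exact Real.rpow_le_rpow (abs_nonneg _) (abs_dotProduct_le _ _) (by linarith)
        _ = (∑ i, a i) ^ 2 := by rw [sq, Finset.sum_mul_sum]
        _ ≤ _ := by
          have := Finset.sum_nonneg fun i (_ : i ∈ Finset.univ) => ha i
          gcongr
    have hdiag : 0 ≤ ∑ i, |dotProduct (z k i) (z k i)| ^ p := by positivity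
    refine mul_le_mul_of_nonneg_left ?_ (by positivity)
    rw [inv_mul_le_iff₀ (by nlinarith)]
    nlinarith [sq_nonneg C, mul_nonneg (sq_nonneg C) (by nlinarith : 0 ≤ N * (N - 2))]

end StandardizedLimits

/-! ### The sample variance, its inverse square root, and standardization -/

section SampleVariance

open Matrix

variable {n m : ℕ}

lemma posSemidef_sampleVar (x : Fin n → Fin m → ℝ) : (sampleVar x).PosSemidef := by
  unfold sampleVar
  refine (posSemidef_sum _ fun i _ => ?_).smul (by positivity)
  simpa using posSemidef_vecMulVec_self_star (x i - sampleMean x)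

section InvSqrt

open scoped MatrixOrder

variable {A : Matrix (Fin m) (Fin m) ℝ}

lemma invSqrt_mul_self (hA : A.PosSemidef) : invSqrt A * invSqrt A = A⁻¹ := by
  rw [invSqrt, ← Matrix.mul_inv_rev, CFC.sqrt_mul_sqrt_self A hA.nonneg]

lemma transpose_invSqrt (A : Matrix (Fin m) (Fin m) ℝ) : (invSqrt A)ᵀ = invSqrt A := by
  have h : (CFC.sqrt A).PosSemidef := (CFC.sqrt_nonneg A).posSemidef
  have h' := h.inv.1
  rwa [IsHermitian, conjTranspose_eq_transpose_of_trivial] at h'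

lemma invSqrt_mul_mul_invSqrt (hA : A.PosSemidef) (hu : IsUnit A.det) :
    invSqrt A * A * invSqrt A = 1 := by
  have hs : IsUnit (CFC.sqrt A).det := by
    rw [← isUnit_iff_isUnit_det, CFC.isUnit_sqrt_iff A hA.nonneg, isUnit_iff_isUnit_det]
    exact hu
  calc invSqrt A * A * invSqrt A
      = ((CFC.sqrt A)⁻¹ * CFC.sqrt A) * (CFC.sqrt A * (CFC.sqrt A)⁻¹) := by
        conv_lhs => rw [invSqrt]; arg 1; arg 2; rw [← CFC.sqrt_mul_sqrt_self A hA.nonneg]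
        simp only [Matrix.mul_assoc]
    _ = 1 := by rw [nonsing_inv_mul _ hs, mul_nonsing_inv _ hs, one_mul]

/-- Symmetry of the root. Invertibility is not needed: for singular `A` both inverses are 0. -/
lemma dotProduct_invSqrt_mulVec (hA : A.PosSemidef) (u v : Fin m → ℝ) :
    dotProduct (invSqrt A *ᵥ u) (invSqrt A *ᵥ v) = dotProduct u (A⁻¹ *ᵥ v) := by
  rw [← invSqrt_mul_self hA, ← mulVec_mulVec, dotProduct_mulVec u, ← mulVec_transpose,
    transpose_invSqrt]

end InvSqrt

lemma abs_dotProduct_mulVec_le (A : Matrix (Fin m) (Fin m) ℝ) (v : Fin m → ℝ) :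
    |dotProduct v (A *ᵥ v)| ≤ (∑ j, ∑ l, |A j l|) * ‖v‖ ^ 2 := by
  have h : dotProduct v (A *ᵥ v) = ∑ j, ∑ l, A j l * (v j * v l) := by
    simp only [dotProduct, mulVec, Finset.mul_sum]
    exact Finset.sum_congr rfl fun j _ => Finset.sum_congr rfl fun l _ => by ring
  rw [h, Finset.sum_mul]
  refine (Finset.abs_sum_le_sum_abs _ _).trans (Finset.sum_le_sum fun j _ => ?_)
  rw [Finset.sum_mul]
  refine (Finset.abs_sum_le_sum_abs _ _).trans (Finset.sum_le_sum fun l _ => ?_)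
  rw [abs_mul, abs_mul, sq]
  gcongr
  · exact norm_le_pi_norm v j
  · exact norm_le_pi_norm v l

lemma sum_sub_eq_smul_sampleMean_sub (hn : 0 < n) (x : Fin n → Fin m → ℝ) (μ : Fin m → ℝ) :
    ∑ i, (x i - μ) = (n : ℝ) • (sampleMean x - μ) := by
  have hn' : (n : ℝ) ≠ 0 := by exact_mod_cast hn.ne'
  rw [Finset.sum_sub_distrib, sampleMean, smul_sub, smul_inv_smul₀ hn']
  simp [Nat.cast_smul_eq_nsmul]

/-- The cross terms vanish because deviations from the sample mean sum to zero. -/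
lemma sum_sub_mul_sub (hn : 0 < n) (x : Fin n → Fin m → ℝ) (μ : Fin m → ℝ) :
    ∑ i, vecMulVec (x i - μ) (x i - μ) = (n : ℝ) • (sampleVar x
      + vecMulVec (sampleMean x - μ) (sampleMean x - μ)) := by
  have hn' : (n : ℝ) ≠ 0 := by exact_mod_cast hn.ne'
  have h0 : ∑ i, (x i - sampleMean x) = 0 := by
    rw [sum_sub_eq_smul_sampleMean_sub hn]; simp
  have h0' : ∀ j, ∑ i, (x i j - sampleMean x j) = 0 := fun j => by
    simpa [Finset.sum_apply] using congrFun h0 j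
  ext j l
  rw [sampleVar, smul_add, smul_inv_smul₀ hn']
  simp only [Matrix.sum_apply, Matrix.add_apply, Matrix.smul_apply, vecMulVec_apply,
    Pi.sub_apply, smul_eq_mul]
  have : ∀ i, (x i j - μ j) * (x i l - μ l)
      = (x i j - sampleMean x j) * (x i l - sampleMean x l)
        + (sampleMean x l - μ l) * (x i j - sampleMean x j)
        + (sampleMean x j - μ j) * (x i l - sampleMean x l)
        + (sampleMean x j - μ j) * (sampleMean x l - μ l) := fun i => by ring
  simp_rw [this, Finset.sum_add_distrib, ← Finset.mul_sum, h0']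
  simp
  ring

lemma rpow_le_one_add_rpow {a p q : ℝ} (ha : 0 ≤ a) (hp : 0 ≤ p) (hpq : p ≤ q) :
    a ^ p ≤ 1 + a ^ q := by
  rcases le_total a 1 with h | h
  · have := Real.rpow_le_one ha h hp
    have := Real.rpow_nonneg ha q
    linarith
  · have := Real.rpow_le_rpow_of_exponent_le h hpq
    linarith

lemma add_rpow_le_two_rpow_mul {a b p : ℝ} (ha : 0 ≤ a) (hb : 0 ≤ b) (hp : 0 ≤ p) :
    (a + b) ^ p ≤ 2 ^ p * (a ^ p + b ^ p) := by
  have hm : 0 ≤ max a b := ha.trans (le_max_left _ _)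
  calc (a + b) ^ p ≤ (2 * max a b) ^ p := by
        refine Real.rpow_le_rpow (by positivity) ?_ hp
        linarith [le_max_left a b, le_max_right a b]
    _ = 2 ^ p * max a b ^ p := Real.mul_rpow (by norm_num) hm
    _ ≤ _ := by
        gcongr
        have h1 := Real.rpow_nonneg ha p
        have h2 := Real.rpow_nonneg hb p
        rcases max_choice a b with h | h <;> rw [h] <;> linarith

/-- The points `Σ̂^{-1/2} (xᵢ - μ)`. -/
def standardize (x : Fin n → Fin m → ℝ) (μ : Fin m → ℝ) : Fin n → Fin m → ℝ :=
  fun i => invSqrt (sampleVar x) *ᵥ (x i - μ)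

/-- The bound `|Σ̂^{-1/2} v|^2 ≤ K ‖v‖^2` yields `K * M ^ 2` for the mean. For the moment, the
centre must be bounded as well: `‖x̄‖ ≤ 1 + M` and `‖x̄ - μ‖ ≤ M` give `‖μ‖ ≤ 1 + 2 * M`. -/
lemma isStandardized_standardize (hn : 0 < n) {x : Fin n → Fin m → ℝ} {μ : Fin m → ℝ}
    {K M p q : ℝ} (hp1 : 1 ≤ p) (hpq : p ≤ q) (hu : IsUnit (sampleVar x).det)
    (hK : ∑ j, ∑ l, |(sampleVar x)⁻¹ j l| ≤ K)
    (hmean : ‖(√(n : ℝ))⁻¹ • ∑ i, (x i - μ)‖ ≤ M)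
    (hmom : (n : ℝ)⁻¹ * ∑ i, ‖x i‖ ^ q ≤ M) :
    IsStandardized (standardize x μ) (invSqrt (sampleVar x) *ᵥ (sampleMean x - μ)) p
      (max (K * M ^ 2) (√K ^ p * (2 ^ p * (1 + M + (1 + 2 * M) ^ p)))) := by
  have hn' : (0 : ℝ) < n := by exact_mod_cast hn
  have hn1 : (1 : ℝ) ≤ n := by exact_mod_cast hn
  have hsq : 0 < √(n : ℝ) := Real.sqrt_pos.2 hn'
  have hA := posSemidef_sampleVar x
  have hM : 0 ≤ M := (norm_nonneg _).trans hmean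
  have hK0 : 0 ≤ K := (Finset.sum_nonneg fun j _ => Finset.sum_nonneg fun l _ => abs_nonneg _).trans
    hK
  have hsum := sum_sub_eq_smul_sampleMean_sub hn x μ
  have hlen : ∀ v : Fin m → ℝ, dotProduct (invSqrt (sampleVar x) *ᵥ v)
      (invSqrt (sampleVar x) *ᵥ v) ≤ K * ‖v‖ ^ 2 := fun v => by
    rw [dotProduct_invSqrt_mulVec hA]
    exact (le_abs_self _).trans ((abs_dotProduct_mulVec_le _ v).trans (by gcongr))
  have hdiff : √(n : ℝ) * ‖sampleMean x - μ‖ ≤ M := by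
    rw [hsum, norm_smul, norm_smul, Real.norm_of_nonneg (inv_nonneg.2 hsq.le),
      Real.norm_of_nonneg hn'.le, ← mul_assoc, ← div_eq_inv_mul, Real.div_sqrt] at hmean
    exact hmean
  have hmom' : ∑ i, ‖x i‖ ^ q ≤ n * M := by rwa [inv_mul_le_iff₀ hn'] at hmom
  have hμ : ‖μ‖ ≤ 1 + 2 * M := by
    have h1 : ‖sampleMean x‖ ≤ 1 + M := by
      rw [sampleMean, norm_smul, Real.norm_of_nonneg (inv_nonneg.2 hn'.le), inv_mul_le_iff₀ hn']
      calc ‖∑ i, x i‖ ≤ ∑ i, ‖x i‖ := norm_sum_le _ _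
        _ ≤ ∑ i, (1 + ‖x i‖ ^ q) := Finset.sum_le_sum fun i _ => by
            simpa using rpow_le_one_add_rpow (norm_nonneg (x i)) zero_le_one (hp1.trans hpq)
        _ ≤ n * (1 + M) := by
            rw [Finset.sum_add_distrib]; simp; linarith
    have h2 : ‖sampleMean x - μ‖ ≤ M := by
      have : 1 ≤ √(n : ℝ) := Real.one_le_sqrt.2 hn1
      nlinarith [norm_nonneg (sampleMean x - μ)]
    calc ‖μ‖ = ‖sampleMean x - (sampleMean x - μ)‖ := by simp
      _ ≤ ‖sampleMean x‖ + ‖sampleMean x - μ‖ := norm_sub_le _ _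
      _ ≤ _ := by linarith
  refine ⟨fun j => ?_, fun j l => ?_, ?_, ?_⟩
  · have : ∑ i, standardize x μ i
        = (n : ℝ) • (invSqrt (sampleVar x) *ᵥ (sampleMean x - μ)) := by
      simp only [standardize]
      rw [← mulVec_smul, ← hsum, mulVec_sum]
    simpa [Finset.sum_apply] using congrFun this j
  · set B := invSqrt (sampleVar x) with hB
    have hvv : ∀ v : Fin m → ℝ, vecMulVec (B *ᵥ v) (B *ᵥ v) = B * vecMulVec v v * B := fun v => by
      rw [mul_vecMulVec, vecMulVec_mul, ← mulVec_transpose, hB, transpose_invSqrt]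
    have : ∑ i, vecMulVec (standardize x μ i) (standardize x μ i) = (n : ℝ) •
        (1 + vecMulVec (B *ᵥ (sampleMean x - μ)) (B *ᵥ (sampleMean x - μ))) := by
      simp only [standardize, ← hB, hvv]
      rw [← Finset.sum_mul, ← Finset.mul_sum, sum_sub_mul_sub hn, mul_smul_comm, smul_mul_assoc,
        Matrix.mul_add, Matrix.add_mul, hB, invSqrt_mul_mul_invSqrt hA hu]
    have := congrFun (congrFun this j) l
    simpa [Matrix.sum_apply, vecMulVec_apply] using this
  · have hterm : ∀ i, √(dotProduct (standardize x μ i) (standardize x μ i)) ^ p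
        ≤ √K ^ p * (2 ^ p * (1 + ‖x i‖ ^ q + (1 + 2 * M) ^ p)) := fun i => by
      have h1 : √(dotProduct (standardize x μ i) (standardize x μ i))
          ≤ √K * (‖x i‖ + (1 + 2 * M)) := by
        refine (Real.sqrt_le_sqrt (hlen (x i - μ))).trans ?_
        rw [Real.sqrt_mul hK0, Real.sqrt_sq (norm_nonneg _)]
        gcongr
        exact (norm_sub_le _ _).trans (by linarith)
      have hp0 : 0 ≤ p := by linarith
      have hx := norm_nonneg (x i)
      calc _ ≤ (√K * (‖x i‖ + (1 + 2 * M))) ^ p := Real.rpow_le_rpow (Real.sqrt_nonneg _) h1 hp0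
        _ = √K ^ p * (‖x i‖ + (1 + 2 * M)) ^ p :=
            Real.mul_rpow (Real.sqrt_nonneg _) (by positivity)
        _ ≤ _ := by
            gcongr
            refine (add_rpow_le_two_rpow_mul hx (by positivity) hp0).trans ?_
            gcongr
            exact rpow_le_one_add_rpow hx hp0 hpq
    calc _ ≤ ∑ i, √K ^ p * (2 ^ p * (1 + ‖x i‖ ^ q + (1 + 2 * M) ^ p)) :=
          Finset.sum_le_sum fun i _ => hterm i
      _ = √K ^ p * (2 ^ p * (n + ∑ i, ‖x i‖ ^ q + n * (1 + 2 * M) ^ p)) := by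
          simp [← Finset.mul_sum, Finset.sum_add_distrib]
      _ ≤ √K ^ p * (2 ^ p * (n + n * M + n * (1 + 2 * M) ^ p)) := by gcongr
      _ = n * (√K ^ p * (2 ^ p * (1 + M + (1 + 2 * M) ^ p))) := by ring
      _ ≤ _ := by gcongr; exact le_max_right _ _
  · refine le_trans ?_ (le_max_left _ _)
    calc (n : ℝ) * _ ≤ n * (K * ‖sampleMean x - μ‖ ^ 2) := by gcongr; exact hlen _
      _ = K * (√(n : ℝ) * ‖sampleMean x - μ‖) ^ 2 := by
          rw [mul_pow, Real.sq_sqrt hn'.le]; ring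
      _ ≤ _ := by gcongr

lemma meanVec_eq_standardize {R : ℕ} (hn : 0 < n) (x : Fin n → Fin m → ℝ) (μ : Fin m → ℝ)
    (π : Fin R → Equiv.Perm (Fin n)) :
    meanVec x μ π = (√(R : ℝ))⁻¹ • ∑ r, drawn (standardize x μ) (π r) 0 := by
  simp [meanVec, drawn, hn, standardize]

lemma uStat_eq_standardize {R : ℕ} (hn : 1 < n) (x : Fin n → Fin m → ℝ) (μ : Fin m → ℝ)
    (π : Fin R → Equiv.Perm (Fin n)) :
    uStat x μ π = (√((m : ℝ) * R))⁻¹ * ∑ r, dotProduct (drawn (standardize x μ) (π r) 0)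
      (drawn (standardize x μ) (π r) 1) := by
  simp only [uStat, drawn, hn, (by omega : 0 < n), dite_true, standardize,
    dotProduct_invSqrt_mulVec (posSemidef_sampleVar x)]

lemma tendsto_inv_of_tendsto {ι : Type*} {l : Filter ι} {A : ι → Matrix (Fin m) (Fin m) ℝ}
    {S : Matrix (Fin m) (Fin m) ℝ} (hS : S.det ≠ 0) (h : Tendsto A l (𝓝 S)) :
    Tendsto (fun k => (A k)⁻¹) l (𝓝 S⁻¹) := by
  simp only [inv_def, Ring.inverse_eq_inv']
  have h1 : Tendsto (fun k => (A k).det) l (𝓝 S.det) :=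
    (Continuous.matrix_det continuous_id).tendsto S |>.comp h
  have h2 : Tendsto (fun k => (A k).adjugate) l (𝓝 S.adjugate) :=
    (Continuous.matrix_adjugate continuous_id).tendsto S |>.comp h
  exact (h1.inv₀ hS).smul h2

end SampleVariance

/-! ### Limit theorems along fixed sequences of data sets -/

section DeterministicData

open scoped Matrix

variable {m : ℕ} {n R : ℕ → ℕ} {x : ∀ k, Fin (n k) → Fin m → ℝ} {μ : ℕ → Fin m → ℝ}
  {S : Matrix (Fin m) (Fin m) ℝ} {δ M : ℝ}

/-- Inversion is continuous at `S`, so eventually `Σ̂` is invertible and the absolute entries of its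
inverse sum to at most the limiting value plus 1: one constant serves all large `k`. The exponent `2
+ δ` is cut off at 3 for the Taylor bound. -/
lemma exists_eventually_isStandardized (hn : Tendsto n atTop atTop) (hS : S.PosDef)
    (hvar : ∀ j l, Tendsto (fun k => sampleVar (x k) j l) atTop (𝓝 (S j l))) (hδ : 0 < δ)
    (hmean : ∀ k, ‖(√(n k : ℝ))⁻¹ • ∑ i, (x k i - μ k)‖ ≤ M)
    (hmom : ∀ k, (n k : ℝ)⁻¹ * ∑ i, ‖x k i‖ ^ (2 + δ) ≤ M) :
    ∃ (d : ℕ → Fin m → ℝ) (p C : ℝ), 2 < p ∧ p ≤ 3 ∧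
      ∀ᶠ k in atTop, IsStandardized (standardize (x k) (μ k)) (d k) p C := by
  have hdet : S.det ≠ 0 := hS.det_pos.ne'
  have hA : Tendsto (fun k => sampleVar (x k)) atTop (𝓝 S) :=
    tendsto_pi_nhds.2 fun j => tendsto_pi_nhds.2 fun l => hvar j l
  have hinv := tendsto_inv_of_tendsto hdet hA
  have hinv' : Tendsto (fun k => ∑ j, ∑ l, |(sampleVar (x k))⁻¹ j l|) atTop
      (𝓝 (∑ j, ∑ l, |S⁻¹ j l|)) :=
    tendsto_finsetSum _ fun j _ => tendsto_finsetSum _ fun l _ =>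
      ((tendsto_pi_nhds.1 (tendsto_pi_nhds.1 hinv j)) l).abs
  have hdetk : ∀ᶠ k in atTop, (sampleVar (x k)).det ≠ 0 :=
    ((Continuous.matrix_det continuous_id).tendsto S |>.comp hA).eventually_ne hdet
  refine ⟨fun k => invSqrt (sampleVar (x k)) *ᵥ (sampleMean (x k) - μ k), min (2 + δ) 3,
    max ((∑ j, ∑ l, |S⁻¹ j l| + 1) * M ^ 2) (√(∑ j, ∑ l, |S⁻¹ j l| + 1) ^ (min (2 + δ) 3) *
      (2 ^ (min (2 + δ) 3) * (1 + M + (1 + 2 * M) ^ (min (2 + δ) 3)))), lt_min (by linarith) (by norm_num), min_le_right _ _, ?_⟩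
  filter_upwards [hdetk, hinv'.eventually_le_const (lt_add_one _), hn.eventually_gt_atTop 0]
    with k h1 h2 h3
  exact isStandardized_standardize h3 (le_min (by linarith) (by norm_num)) (min_le_left _ _)
    h1.isUnit h2 (hmean k) (hmom k)

/-- The law of a statistic of `R` i.i.d. uniform permutations of `Fin n`. -/
def statLaw {E : Type*} [MeasurableSpace E] {n R : ℕ} (T : (Fin R → Equiv.Perm (Fin n)) → E) :
    ProbabilityMeasure E :=
  ⟨(permLaw n R).map T, Measure.isProbabilityMeasure_map Measurable.of_discrete.aemeasurable⟩

/-- Conditional limit theorem for the mean-type vector along a fixed sequence of data sets. -/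
theorem tendsto_statLaw_meanVec (hn : Tendsto n atTop atTop) (hR : Tendsto R atTop atTop)
    (hRn : Tendsto (fun k => (R k : ℝ) / n k) atTop (𝓝 0)) (hS : S.PosDef)
    (hvar : ∀ j l, Tendsto (fun k => sampleVar (x k) j l) atTop (𝓝 (S j l))) (hδ : 0 < δ)
    (hmean : ∀ k, ‖(√(n k : ℝ))⁻¹ • ∑ i, (x k i - μ k)‖ ≤ M)
    (hmom : ∀ k, (n k : ℝ)⁻¹ * ∑ i, ‖x k i‖ ^ (2 + δ) ≤ M) :
    Tendsto (fun k => statLaw (R := R k) (meanVec (x k) (μ k))) atTop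
      (𝓝 (⟨stdNormal m, inferInstance⟩ : ProbabilityMeasure (Fin m → ℝ))) := by
  obtain ⟨d, p, C, hp2, hp3, hz⟩ := exists_eventually_isStandardized hn hS hvar hδ hmean hmom
  refine tendsto_stdNormal_of_tendsto_integral_exp _ fun t => ?_
  refine (tendsto_integral_exp_mean hn hR hRn hp2 hp3 hz t).congr' ?_
  filter_upwards [hn.eventually_gt_atTop 0] with k hk
  simp only [statLaw, ProbabilityMeasure.coe_mk]
  rw [integral_map Measurable.of_discrete.aemeasurable (Measurable.aestronglyMeasurable (by
    simp only [dotProduct]; fun_prop))]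
  simp_rw [meanVec_eq_standardize hk]

theorem tendsto_statLaw_meanStat (hn : Tendsto n atTop atTop) (hR : Tendsto R atTop atTop)
    (hRn : Tendsto (fun k => (R k : ℝ) / n k) atTop (𝓝 0)) (hS : S.PosDef)
    (hvar : ∀ j l, Tendsto (fun k => sampleVar (x k) j l) atTop (𝓝 (S j l))) (hδ : 0 < δ)
    (hmean : ∀ k, ‖(√(n k : ℝ))⁻¹ • ∑ i, (x k i - μ k)‖ ≤ M)
    (hmom : ∀ k, (n k : ℝ)⁻¹ * ∑ i, ‖x k i‖ ^ (2 + δ) ≤ M) :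
    Tendsto (fun k => statLaw (R := R k) (meanStat (x k) (μ k))) atTop
      (𝓝 (⟨chiSquare m, inferInstance⟩ : ProbabilityMeasure ℝ)) := by
  have hc : Continuous fun z : Fin m → ℝ => ∑ i, z i ^ 2 := by fun_prop
  have h := ProbabilityMeasure.tendsto_map_of_tendsto_of_continuous _ _
    (tendsto_statLaw_meanVec hn hR hRn hS hvar hδ hmean hmom) hc
  refine h.congr fun k => Subtype.ext ?_
  simp only [statLaw, ProbabilityMeasure.map, ProbabilityMeasure.coe_mk]
  rw [Measure.map_map hc.measurable Measurable.of_discrete]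
  congr 1
  funext π
  simp [meanStat, dotProduct, sq]

/-- Conditional limit theorem for the U-type statistic along a fixed sequence of data sets. -/
theorem tendsto_statLaw_uStat (hm : 0 < m) (hn : Tendsto n atTop atTop)
    (hR : Tendsto R atTop atTop)
    (hRn : Tendsto (fun k => √(R k : ℝ) / n k) atTop (𝓝 0)) (hS : S.PosDef)
    (hvar : ∀ j l, Tendsto (fun k => sampleVar (x k) j l) atTop (𝓝 (S j l))) (hδ : 0 < δ)
    (hmean : ∀ k, ‖(√(n k : ℝ))⁻¹ • ∑ i, (x k i - μ k)‖ ≤ M)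
    (hmom : ∀ k, (n k : ℝ)⁻¹ * ∑ i, ‖x k i‖ ^ (2 + δ) ≤ M) :
    Tendsto (fun k => statLaw (R := R k) (uStat (x k) (μ k))) atTop
      (𝓝 (⟨gaussianReal 0 1, inferInstance⟩ : ProbabilityMeasure ℝ)) := by
  obtain ⟨d, p, C, hp2, hp3, hz⟩ := exists_eventually_isStandardized hn hS hvar hδ hmean hmom
  refine tendsto_gaussianReal_of_tendsto_integral_exp _ fun s => ?_
  refine (tendsto_integral_exp_uStat hm hn hR hRn hp2 hp3 hz s).congr' ?_
  filter_upwards [hn.eventually_gt_atTop 1] with k hk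
  simp only [statLaw, ProbabilityMeasure.coe_mk]
  rw [integral_map Measurable.of_discrete.aemeasurable (Measurable.aestronglyMeasurable (by
    fun_prop))]
  simp_rw [uStat_eq_standardize hk]

end DeterministicData

/-! ### From deterministic sequences to convergence in probability -/

section Transfer

/-- A family of maps `L n` on data sets of size `n` converges to `y` along every sequence of data
sets, of sizes tending to infinity, for which the norms of `a₁` and `a₂` are bounded and every
`b i` converges to `c i`. -/
def TendstoAlongData {D : ℕ → Type*} {E₁ E₂ ι Y : Type*} [Norm E₁] [Norm E₂] [TopologicalSpace Y]
    (a₁ : ∀ n, D n → E₁) (a₂ : ∀ n, D n → E₂) (b : ι → ∀ n, D n → ℝ) (c : ι → ℝ)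
    (L : ∀ n, D n → Y) (y : Y) : Prop :=
  ∀ (n : ℕ → ℕ) (x : ∀ k, D (n k)) (M : ℝ), Tendsto n atTop atTop →
    (∀ k, ‖a₁ (n k) (x k)‖ ≤ M) → (∀ k, ‖a₂ (n k) (x k)‖ ≤ M) →
    (∀ i, Tendsto (fun k => b i (n k) (x k)) atTop (𝓝 (c i))) →
    Tendsto (fun k => L (n k) (x k)) atTop (𝓝 y)

variable {D : ℕ → Type*} {E₁ E₂ ι : Type*} [Norm E₁] [Norm E₂]
  {a₁ : ∀ n, D n → E₁} {a₂ : ∀ n, D n → E₂} {b : ι → ∀ n, D n → ℝ} {c : ι → ℝ}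
  {Ω : ℕ → Type*} [∀ n, MeasurableSpace (Ω n)] {P : ∀ n, Measure (Ω n)}
  {X : ∀ n, Ω n → D n}

/-- If uniformity fails, tolerances `1 / (k + 1)` and sizes at least `k` produce a good sequence of
data sets that violates the limit. Its sizes may skip or repeat, which is why `TendstoAlongData`
allows any size sequence tending to infinity. -/
lemma TendstoAlongData.exists_forall_abs_sub_le {f : ∀ n, D n → ℝ} {y : ℝ}
    (h : TendstoAlongData a₁ a₂ b c f y) {ε : ℝ} (hε : 0 < ε) (M : ℝ) :
    ∃ η : ℝ, 0 < η ∧ ∃ N : ℕ, ∀ n, N ≤ n → ∀ x : D n, ‖a₁ n x‖ ≤ M → ‖a₂ n x‖ ≤ M →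
      (∀ i, |b i n x - c i| ≤ η) → |f n x - y| ≤ ε := by
  by_contra hcon
  push Not at hcon
  choose n hn x h1 h2 h3 h4 using fun k : ℕ => hcon (1 / ((k : ℝ) + 1)) (by positivity) k
  have hlim := h n x M (tendsto_atTop_mono hn tendsto_id) h1 h2 fun i => by
    rw [tendsto_iff_norm_sub_tendsto_zero]
    exact squeeze_zero (fun _ => norm_nonneg _) (fun k => h3 k i)
      tendsto_one_div_add_atTop_nhds_zero_nat
  have hev := (Metric.tendsto_nhds.1 hlim) ε hε
  obtain ⟨k, hk⟩ := hev.exists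
  rw [Real.dist_eq] at hk
  exact absurd hk (not_lt.2 (h4 k).le)

/-- Convergence along good sequences of data sets implies convergence in probability. -/
theorem TendstoAlongData.tendstoInProb [Fintype ι] {f : ∀ n, D n → ℝ} {y : ℝ}
    (h : TendstoAlongData a₁ a₂ b c f y)
    (h₁ : BoundedInProb P fun n ω => a₁ n (X n ω)) (h₂ : BoundedInProb P fun n ω => a₂ n (X n ω))
    (hb : ∀ i, TendstoInProb P (fun n ω => b i n (X n ω)) (c i)) :
    TendstoInProb P (fun n ω => f n (X n ω)) y := by
  intro ε hε
  rw [ENNReal.tendsto_nhds_zero]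
  intro ε' hε'
  obtain ⟨e, he, hee⟩ : ∃ e : ℝ, 0 < e ∧ ENNReal.ofReal e ≤ ε' / 3 := by
    have h3 : 0 < ε' / 3 := ENNReal.div_pos hε'.ne' (by norm_num)
    obtain ⟨e, he0, he⟩ := ENNReal.lt_iff_exists_nnreal_btwn.1 h3
    refine ⟨e, by exact_mod_cast he0, ?_⟩
    rw [ENNReal.ofReal_coe_nnreal]
    exact he.le
  obtain ⟨M₁, hM₁⟩ := h₁ e he
  obtain ⟨M₂, hM₂⟩ := h₂ e he
  obtain ⟨η, hη, N, hN⟩ := h.exists_forall_abs_sub_le hε (max M₁ M₂)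
  have hsum : Tendsto (fun n => ∑ i, P n {ω | η < |b i n (X n ω) - c i|}) atTop (𝓝 0) := by
    simpa using tendsto_finsetSum Finset.univ fun i _ => hb i η hη
  have hsum' := (ENNReal.tendsto_nhds_zero.1 hsum) (ε' / 3)
    (ENNReal.div_pos hε'.ne' (by norm_num))
  filter_upwards [hM₁, hM₂, hsum', eventually_ge_atTop N] with n h1 h2 h3 hn
  -- Only monotonicity and subadditivity of the measure are used, so `f` need not be measurable;
  -- this matters for suprema over all `t`.
  have hsub : {ω | ε < |f n (X n ω) - y|} ⊆ ({ω | M₁ < ‖a₁ n (X n ω)‖} ∪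
      {ω | M₂ < ‖a₂ n (X n ω)‖}) ∪ ⋃ i ∈ Finset.univ, {ω | η < |b i n (X n ω) - c i|} := by
    intro ω hω
    by_contra hcon
    simp only [Set.mem_union, Set.mem_iUnion, Set.mem_ofPred_eq, not_or, not_exists, not_lt,
      Finset.mem_univ, true_implies] at hcon hω
    exact absurd (hN n hn (X n ω) (hcon.1.1.trans (le_max_left _ _))
      (hcon.1.2.trans (le_max_right _ _)) fun i => hcon.2 i) (not_le.2 hω)
  calc P n {ω | ε < |f n (X n ω) - y|} ≤ _ := measure_mono hsub
    _ ≤ P n {ω | M₁ < ‖a₁ n (X n ω)‖} + P n {ω | M₂ < ‖a₂ n (X n ω)‖}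
        + ∑ i, P n {ω | η < |b i n (X n ω) - c i|} :=
        (measure_union_le _ _).trans (add_le_add (measure_union_le _ _)
          (measure_biUnion_finset_le _ _))
    _ ≤ ε' / 3 + ε' / 3 + ε' / 3 := add_le_add (add_le_add (h1.trans hee) (h2.trans hee)) h3
    _ = ε' := ENNReal.add_thirds ε'

lemma TendstoInProb.congr_ae {f g : ∀ n, Ω n → ℝ} {y : ℝ} (h : TendstoInProb P f y)
    (hfg : ∀ n, f n =ᵐ[P n] g n) : TendstoInProb P g y := by
  intro ε hε
  refine (h ε hε).congr fun n => measure_congr ?_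
  filter_upwards [hfg n] with ω hω
  change (ε < |f n ω - y|) = (ε < |g n ω - y|)
  rw [hω]

/-- Bounded convergence with a varying probability space: the integrand is split according to
whether the deviation exceeds `ε`. -/
lemma TendstoInProb.tendsto_integral [∀ n, IsProbabilityMeasure (P n)] {f : ∀ n, Ω n → ℝ}
    {y K : ℝ} (h : TendstoInProb P f y) (hf : ∀ n, Measurable (f n)) (hK : ∀ n ω, |f n ω| ≤ K) :
    Tendsto (fun n => ∫ ω, f n ω ∂P n) atTop (𝓝 y) := by
  have hint : ∀ n, Integrable (f n) (P n) := fun n =>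
    Integrable.of_bound (hf n).aestronglyMeasurable K (Eventually.of_forall (hK n))
  have hK0 : 0 ≤ K + |y| := by
    obtain ⟨ω⟩ := (P 0).nonempty_of_neZero
    exact add_nonneg ((abs_nonneg _).trans (hK 0 ω)) (abs_nonneg _)
  have hbound : ∀ n ε, 0 < ε → |∫ ω, f n ω ∂P n - y|
      ≤ ε + (K + |y|) * (P n).real {ω | ε < |f n ω - y|} := by
    intro n ε hε
    have hms : MeasurableSet {ω | ε < |f n ω - y|} :=
      measurableSet_lt measurable_const (((hf n).sub_const y).abs)
    have e1 : ∫ ω, f n ω ∂P n - y = ∫ ω, (f n ω - y) ∂P n := by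
      rw [integral_sub (hint n) (integrable_const _)]; simp
    rw [e1]
    refine (abs_integral_le_integral_abs).trans ?_
    calc ∫ ω, |f n ω - y| ∂P n
        ≤ ∫ ω, (ε + {ω | ε < |f n ω - y|}.indicator (fun _ => K + |y|) ω) ∂P n := by
          refine integral_mono ((hint n).sub (integrable_const _)).abs
            ((integrable_const _).add ((integrable_const _).indicator hms)) fun ω => ?_
          by_cases hω : ε < |f n ω - y|
          · have : |f n ω - y| ≤ K + |y| := (abs_sub _ _).trans (by gcongr; exact hK n ω)
            simp only [Set.indicator, Set.mem_ofPred_eq, hω, if_true]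
            linarith
          · simp only [Set.indicator, Set.mem_ofPred_eq, hω, if_false]
            linarith
      _ = _ := by
          rw [integral_add (integrable_const _) ((integrable_const _).indicator hms),
            integral_indicator_const _ hms]
          simp [mul_comm]
  rw [Metric.tendsto_nhds]
  intro ε hε
  have hP : Tendsto (fun n => (K + |y|) * (P n).real {ω | ε / 2 < |f n ω - y|}) atTop (𝓝 0) := by
    have := (ENNReal.tendsto_toReal ENNReal.zero_ne_top).comp (h (ε / 2) (by positivity))
    simpa [measureReal_def] using this.const_mul (K + |y|)
  filter_upwards [hP.eventually_lt_const (by positivity : 0 < ε / 2)] with n hn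
  rw [Real.dist_eq]
  linarith [hbound n (ε / 2) (by positivity)]

end Transfer

/-! ### Conditional laws under independence -/

section ConditionalLaw

variable {Ω D Γ E : Type*} [MeasurableSpace Ω] [MeasurableSpace D] [MeasurableSpace Γ]
  [MeasurableSpace E] {P : Measure Ω} [IsProbabilityMeasure P] {X : Ω → D} {π : Ω → Γ}

/-- If `π` is independent of `X`, the conditional law of `T (X, π)` given `X = x` is the law of
`T (x, π)`. -/
theorem condDistrib_of_indepFun [StandardBorelSpace E] [Nonempty E] (hX : Measurable X)
    (hπ : Measurable π) (hind : IndepFun X π P) {T : D × Γ → E} (hT : Measurable T) :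
    ∀ᵐ ω ∂P, condDistrib (fun ω => T (X ω, π ω)) X P (X ω)
      = (P.map π).map fun g => T (X ω, g) := by
  have := Measure.isProbabilityMeasure_map (μ := P) hπ.aemeasurable
  have := Measure.isProbabilityMeasure_map (μ := P) hX.aemeasurable
  let κ : Kernel D E := (Kernel.id ×ₖ Kernel.const D (P.map π)).map T
  have hκ : ∀ x, κ x = (P.map π).map fun g => T (x, g) := fun x => by
    simp only [κ]
    rw [Kernel.map_apply _ hT, Kernel.prod_apply, Kernel.id_apply, Kernel.const_apply,
      Measure.dirac_prod, Measure.map_map hT measurable_prodMk_left]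
    rfl
  have : IsMarkovKernel κ := Kernel.IsMarkovKernel.map _ hT
  have hjoint : P.map (fun ω => (X ω, π ω)) = (P.map X).prod (P.map π) :=
    (indepFun_iff_map_prod_eq_prod_map_map hX.aemeasurable hπ.aemeasurable).1 hind
  have hq : Measurable fun q : D × Γ => (q.1, T q) := measurable_fst.prodMk hT
  -- Disintegrations are almost everywhere unique, so this identity, which is Fubini for the product
  -- law of `(X, π)`, determines the conditional law.
  have hmain : P.map (fun ω => (X ω, T (X ω, π ω))) = P.map X ⊗ₘ κ := by
    have : P.map (fun ω => (X ω, T (X ω, π ω)))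
        = (P.map fun ω => (X ω, π ω)).map fun q => (q.1, T q) := by
      rw [Measure.map_map hq (hX.prodMk hπ)]; rfl
    rw [this, hjoint]
    ext s hs
    rw [Measure.map_apply hq hs, Measure.prod_apply (hq hs), Measure.compProd_apply hs]
    refine lintegral_congr fun x => ?_
    have hTx : Measurable fun g => T (x, g) := hT.comp measurable_prodMk_left
    rw [hκ, Measure.map_apply hTx (measurable_prodMk_left hs)]
    rfl
  have hae := condDistrib_ae_eq_of_measure_eq_compProd_of_measurable hX
    (hT.comp (hX.prodMk hπ)) hmain
  filter_upwards [ae_of_ae_map hX.aemeasurable hae] with ω hω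
  rw [← hκ]
  exact hω

lemma integral_comp_of_indepFun (hX : Measurable X) (hπ : Measurable π) (hind : IndepFun X π P)
    {f : D × Γ → ℝ} (hf : Measurable f) {K : ℝ} (hK : ∀ q, |f q| ≤ K) :
    ∫ ω, f (X ω, π ω) ∂P = ∫ ω, ∫ g, f (X ω, g) ∂(P.map π) ∂P := by
  have := Measure.isProbabilityMeasure_map (μ := P) hπ.aemeasurable
  have := Measure.isProbabilityMeasure_map (μ := P) hX.aemeasurable
  have hjoint : P.map (fun ω => (X ω, π ω)) = (P.map X).prod (P.map π) :=
    (indepFun_iff_map_prod_eq_prod_map_map hX.aemeasurable hπ.aemeasurable).1 hind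
  rw [← integral_map (hX.prodMk hπ).aemeasurable hf.aestronglyMeasurable, hjoint,
    integral_prod _ (Integrable.of_bound hf.aestronglyMeasurable K (Eventually.of_forall hK)),
    integral_map hX.aemeasurable]
  exact hf.stronglyMeasurable.integral_prod_right'.aestronglyMeasurable

end ConditionalLaw

/-! ### Joint measurability of the statistics -/

section Measurability

open scoped Matrix

variable {n m R : ℕ}

lemma continuous_sampleMean : Continuous (sampleMean : (Fin n → Fin m → ℝ) → Fin m → ℝ) := by
  unfold sampleMean; fun_prop

lemma continuous_sampleVar : Continuous (sampleVar : (Fin n → Fin m → ℝ) → _) := by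
  have := continuous_sampleMean (n := n) (m := m)
  refine continuous_pi fun j => continuous_pi fun l => ?_
  simp only [sampleVar, Matrix.smul_apply, Matrix.sum_apply, Matrix.vecMulVec_apply, Pi.sub_apply]
  fun_prop

/-- Inversion may be discontinuous at singular matrices, but it is the adjugate times the inverse of
the determinant, and real inversion with `0⁻¹ = 0` is measurable. -/
lemma measurable_inv_apply {α : Type*} [TopologicalSpace α] [MeasurableSpace α]
    [OpensMeasurableSpace α] {A : α → Matrix (Fin m) (Fin m) ℝ} (hA : Continuous A)
    (j l : Fin m) : Measurable fun x => (A x)⁻¹ j l := by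
  simp only [Matrix.inv_def, Ring.inverse_eq_inv', Matrix.smul_apply, smul_eq_mul]
  exact (hA.matrix_det.measurable.inv).mul (hA.matrix_adjugate.matrix_elem j l).measurable

open scoped MatrixOrder Matrix.Norms.L2Operator in
lemma continuousOn_matrix_sqrt :
    ContinuousOn (CFC.sqrt : Matrix (Fin m) (Fin m) ℝ → _) {A | 0 ≤ A} :=
  CFC.continuousOn_sqrt

open scoped MatrixOrder in
lemma measurable_invSqrt_sampleVar_apply (j l : Fin m) :
    Measurable fun x : Fin n → Fin m → ℝ => invSqrt (sampleVar x) j l :=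
  measurable_inv_apply (continuousOn_matrix_sqrt.comp_continuous continuous_sampleVar
    fun x => (posSemidef_sampleVar x).nonneg) j l

lemma measurable_drawn_apply (σ : Equiv.Perm (Fin n)) (k : ℕ) (j : Fin m) :
    Measurable fun x : Fin n → Fin m → ℝ => drawn x σ k j := by
  unfold drawn
  split_ifs
  · fun_prop
  · exact measurable_const

variable {μ : (Fin n → Fin m → ℝ) → Fin m → ℝ}

lemma measurable_meanVec (hμ : Measurable μ) :
    Measurable fun q : (Fin n → Fin m → ℝ) × (Fin R → Equiv.Perm (Fin n)) =>
      meanVec q.1 (μ q.1) q.2 := by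
  -- There are finitely many permutation tuples, so each may be fixed.
  refine measurable_from_prod_countable_left fun π => ?_
  refine measurable_pi_iff.2 fun j => ?_
  simp only [meanVec, Pi.smul_apply, Finset.sum_apply, Matrix.mulVec, dotProduct, Pi.sub_apply,
    smul_eq_mul]
  refine Measurable.const_mul ?_ _
  refine Finset.measurable_sum _ fun r _ => Finset.measurable_sum _ fun l _ => ?_
  exact (measurable_invSqrt_sampleVar_apply j l).mul
    ((measurable_drawn_apply (π r) 0 l).sub ((measurable_pi_apply l).comp hμ))

lemma measurable_meanStat (hμ : Measurable μ) :
    Measurable fun q : (Fin n → Fin m → ℝ) × (Fin R → Equiv.Perm (Fin n)) =>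
      meanStat q.1 (μ q.1) q.2 := by
  have h := measurable_pi_iff.1 (measurable_meanVec (R := R) hμ)
  unfold meanStat dotProduct
  exact Finset.measurable_sum _ fun j _ => (h j).mul (h j)

lemma measurable_uStat (hμ : Measurable μ) :
    Measurable fun q : (Fin n → Fin m → ℝ) × (Fin R → Equiv.Perm (Fin n)) =>
      uStat q.1 (μ q.1) q.2 := by
  refine measurable_from_prod_countable_left fun π => ?_
  simp only [uStat, Matrix.mulVec, dotProduct, Pi.sub_apply]
  refine (Finset.measurable_sum _ fun r _ => Finset.measurable_sum _ fun j _ => ?_).const_mul _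
  refine ((measurable_drawn_apply (π r) 0 j).sub ((measurable_pi_apply j).comp hμ)).mul
    (Finset.measurable_sum _ fun l _ => ?_)
  exact (measurable_inv_apply continuous_sampleVar j l).mul
    ((measurable_drawn_apply (π r) 1 l).sub ((measurable_pi_apply l).comp hμ))

end Measurability

/-! ### Conditional and unconditional limits for random data -/

section ConditionalLimits

variable {m : ℕ} {Ω : ℕ → Type*} [∀ n, MeasurableSpace (Ω n)] {P : ∀ n, Measure (Ω n)}
  [∀ n, IsProbabilityMeasure (P n)] {X : ∀ n, Ω n → Fin n → Fin m → ℝ} {R : ℕ → ℕ}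
  {π : ∀ n, Ω n → Fin (R n) → Equiv.Perm (Fin n)}
  {E : Type*} [MeasurableSpace E]
  {T : ∀ n, (Fin n → Fin m → ℝ) → (Fin (R n) → Equiv.Perm (Fin n)) → E}
  {E₁ E₂ ι : Type*} [Norm E₁] [Norm E₂] [Fintype ι]
  {a₁ : ∀ n, (Fin n → Fin m → ℝ) → E₁} {a₂ : ∀ n, (Fin n → Fin m → ℝ) → E₂}
  {b : ι → ∀ n, (Fin n → Fin m → ℝ) → ℝ} {c : ι → ℝ}

lemma map_eq_permLaw {Ω : Type*} [MeasurableSpace Ω] {P : Measure Ω} [IsProbabilityMeasure P]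
    {n R : ℕ} {π : Ω → Fin R → Equiv.Perm (Fin n)} (hπ : Measurable π)
    (hunif : ∀ r, P.map (fun ω => π ω r) = uniformOn Set.univ)
    (hiid : iIndepFun (fun r ω => π ω r) P) : P.map π = permLaw n R := by
  have h := (iIndepFun_iff_map_fun_eq_pi_map (f := fun r ω => π ω r) fun r =>
    ((measurable_pi_apply r).comp hπ).aemeasurable).1 hiid
  rw [funext hunif] at h
  exact h

/-- The conditional law given the data of a statistic of the data and the permutations. -/
lemma condDistrib_eq_statLaw [StandardBorelSpace E] [Nonempty E] (hX : ∀ n, Measurable (X n))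
    (hπ : ∀ n, Measurable (π n)) (hlaw : ∀ n, (P n).map (π n) = permLaw n (R n))
    (hdata : ∀ n, IndepFun (X n) (π n) (P n)) (hT : ∀ n, Measurable (Function.uncurry (T n)))
    (n : ℕ) : ∀ᵐ ω ∂P n, condDistrib (fun ω => T n (X n ω) (π n ω)) (X n) (P n) (X n ω)
      = statLaw (T n (X n ω)) := by
  have h := condDistrib_of_indepFun (hX n) (hπ n) (hdata n) (hT n)
  rw [hlaw n] at h
  exact h

/-- If the law of `T n x` converges weakly along good sequences of data sets, then the statistic
converges in distribution. -/
theorem TendstoAlongData.tendstoInDistribution [TopologicalSpace E] [OpensMeasurableSpace E]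
    (hX : ∀ n, Measurable (X n)) (hπ : ∀ n, Measurable (π n))
    (hlaw : ∀ n, (P n).map (π n) = permLaw n (R n))
    (hdata : ∀ n, IndepFun (X n) (π n) (P n)) (hT : ∀ n, Measurable (Function.uncurry (T n)))
    {ν : Measure E} [hν : IsProbabilityMeasure ν]
    (h : TendstoAlongData a₁ a₂ b c (fun n x => statLaw (T n x)) ⟨ν, hν⟩)
    (h₁ : BoundedInProb P fun n ω => a₁ n (X n ω)) (h₂ : BoundedInProb P fun n ω => a₂ n (X n ω))
    (hb : ∀ i, TendstoInProb P (fun n ω => b i n (X n ω)) (c i)) :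
    TendstoInDistribution (fun n ω => T n (X n ω) (π n ω)) atTop id P ν := by
  have hTm : ∀ n, Measurable fun ω => T n (X n ω) (π n ω) := fun n =>
    (hT n).comp ((hX n).prodMk (hπ n))
  refine ⟨fun n => (hTm n).aemeasurable, aemeasurable_id, ?_⟩
  refine ProbabilityMeasure.tendsto_iff_forall_integral_tendsto.2 fun f => ?_
  simp only [ProbabilityMeasure.coe_mk, Measure.map_id]
  have hfT : ∀ n, Measurable fun q : (Fin n → Fin m → ℝ) × (Fin (R n) → Equiv.Perm (Fin n)) =>
      f (T n q.1 q.2) := fun n => f.continuous.measurable.comp (hT n)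
  -- The conditional expectations of `f` converge in probability to a constant and are bounded by
  -- `‖f‖`, so their means, the unconditional expectations, converge too.
  have hprob : TendstoInProb P (fun n ω => ∫ g, f (T n (X n ω) g) ∂(permLaw n (R n)))
      (∫ y, f y ∂ν) := by
    refine TendstoAlongData.tendstoInProb
      (f := fun n x => ∫ g, f (T n x g) ∂(permLaw n (R n))) (fun k x M hk h1 h2 h3 => ?_) h₁ h₂ hb
    have := (ProbabilityMeasure.tendsto_iff_forall_integral_tendsto.1 (h k x M hk h1 h2 h3)) f
    refine this.congr fun j => ?_
    exact integral_map Measurable.of_discrete.aemeasurable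
      f.continuous.measurable.aestronglyMeasurable
  have hlim := hprob.tendsto_integral (K := ‖f‖) (fun n => ?_) fun n ω => ?_
  · refine hlim.congr fun n => ?_
    rw [integral_map (hTm n).aemeasurable f.continuous.measurable.aestronglyMeasurable, ← hlaw n]
    exact (integral_comp_of_indepFun (hX n) (hπ n) (hdata n) (hfT n)
      fun q => f.norm_coe_le_norm _).symm
  · exact (hfT n).stronglyMeasurable.integral_prod_right'.measurable.comp (hX n)
  · refine (norm_integral_le_of_norm_le_const (C := ‖f‖)
      (Eventually.of_forall fun g => f.norm_coe_le_norm _)).trans ?_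
    simp

/-- If the law of `T n x` converges weakly along good sequences of data sets, then a functional of
the conditional law given the data converges in probability. -/
theorem TendstoAlongData.tendstoInProb_condDistrib [TopologicalSpace E] [OpensMeasurableSpace E]
    [StandardBorelSpace E] [Nonempty E]
    (hX : ∀ n, Measurable (X n)) (hπ : ∀ n, Measurable (π n))
    (hlaw : ∀ n, (P n).map (π n) = permLaw n (R n))
    (hdata : ∀ n, IndepFun (X n) (π n) (P n)) (hT : ∀ n, Measurable (Function.uncurry (T n)))
    {ν : ProbabilityMeasure E} (h : TendstoAlongData a₁ a₂ b c (fun n x => statLaw (T n x)) ν)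
    (h₁ : BoundedInProb P fun n ω => a₁ n (X n ω)) (h₂ : BoundedInProb P fun n ω => a₂ n (X n ω))
    (hb : ∀ i, TendstoInProb P (fun n ω => b i n (X n ω)) (c i))
    (F : Measure E → ℝ) {y : ℝ}
    (hF : ∀ ρ : ℕ → ProbabilityMeasure E, Tendsto ρ atTop (𝓝 ν) →
      Tendsto (fun k => F (ρ k)) atTop (𝓝 y)) :
    TendstoInProb P
      (fun n ω => F (condDistrib (fun ω => T n (X n ω) (π n ω)) (X n) (P n) (X n ω))) y := by
  have hprob : TendstoInProb P (fun n ω => F (statLaw (T n (X n ω)))) y :=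
    TendstoAlongData.tendstoInProb (f := fun n x => F (statLaw (T n x)))
      (fun k x M hk h1 h2 h3 => hF _ (h k x M hk h1 h2 h3)) h₁ h₂ hb
  refine hprob.congr_ae fun n => ?_
  filter_upwards [condDistrib_eq_statLaw hX hπ hlaw hdata hT n] with ω hω
  rw [hω]

end ConditionalLimits

/-! ### The three statistics along good samples -/

section Statistics

variable {m : ℕ} (μ : ∀ n, (Fin n → Fin m → ℝ) → Fin m → ℝ) {R : ℕ → ℕ}
  {S : Matrix (Fin m) (Fin m) ℝ} {δ : ℝ}

/-- Convergence along data sets with `√n (x̄ - μ)` and the absolute sample moment of order `2 + δ`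
bounded, and sample variance matrix converging to `S`. -/
abbrev TendstoAlongSamples {Y : Type*} [TopologicalSpace Y]
    (μ : ∀ n, (Fin n → Fin m → ℝ) → Fin m → ℝ) (S : Matrix (Fin m) (Fin m) ℝ) (δ : ℝ)
    (L : ∀ n, (Fin n → Fin m → ℝ) → Y) (y : Y) : Prop :=
  TendstoAlongData (fun n x => (√(n : ℝ))⁻¹ • ∑ i, (x i - μ n x))
    (fun n x => (n : ℝ)⁻¹ * ∑ i, ‖x i‖ ^ (2 + δ))
    (fun (jl : Fin m × Fin m) _ x => sampleVar x jl.1 jl.2) (fun jl => S jl.1 jl.2) L y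

lemma tendstoAlongSamples_meanVec (hS : S.PosDef) (hδ : 0 < δ) (hR : Tendsto R atTop atTop)
    (hRn : Tendsto (fun n => (R n : ℝ) / n) atTop (𝓝 0)) :
    TendstoAlongSamples μ S δ (fun n x => statLaw (R := R n) (meanVec x (μ n x)))
      ⟨stdNormal m, inferInstance⟩ := fun n x _ hn h1 h2 h3 =>
  tendsto_statLaw_meanVec (R := fun k => R (n k)) (μ := fun k => μ (n k) (x k)) hn (hR.comp hn)
    (hRn.comp hn) hS (fun j l => h3 (j, l)) hδ h1 fun k => (le_abs_self _).trans (h2 k)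

lemma tendstoAlongSamples_meanStat (hS : S.PosDef) (hδ : 0 < δ) (hR : Tendsto R atTop atTop)
    (hRn : Tendsto (fun n => (R n : ℝ) / n) atTop (𝓝 0)) :
    TendstoAlongSamples μ S δ (fun n x => statLaw (R := R n) (meanStat x (μ n x)))
      ⟨chiSquare m, inferInstance⟩ := fun n x _ hn h1 h2 h3 =>
  tendsto_statLaw_meanStat (R := fun k => R (n k)) (μ := fun k => μ (n k) (x k)) hn (hR.comp hn)
    (hRn.comp hn) hS (fun j l => h3 (j, l)) hδ h1 fun k => (le_abs_self _).trans (h2 k)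

lemma tendstoAlongSamples_uStat (hm : 0 < m) (hS : S.PosDef) (hδ : 0 < δ)
    (hR : Tendsto R atTop atTop) (hRn : Tendsto (fun n => √(R n : ℝ) / n) atTop (𝓝 0)) :
    TendstoAlongSamples μ S δ (fun n x => statLaw (R := R n) (uStat x (μ n x)))
      ⟨gaussianReal 0 1, inferInstance⟩ := fun n x _ hn h1 h2 h3 =>
  tendsto_statLaw_uStat hm (R := fun k => R (n k)) (μ := fun k => μ (n k) (x k)) hn (hR.comp hn)
    (hRn.comp hn) hS (fun j l => h3 (j, l)) hδ h1 fun k => (le_abs_self _).trans (h2 k)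

/-- The deviations sum to zero, so root-`n` consistency is automatic when the centre is the sample
mean. -/
lemma boundedInProb_sampleMean_sub {Ω : ℕ → Type*} [∀ n, MeasurableSpace (Ω n)]
    (P : ∀ n, Measure (Ω n)) (X : ∀ n, Ω n → Fin n → Fin m → ℝ) :
    BoundedInProb P fun n ω => (√(n : ℝ))⁻¹ • ∑ i, (X n ω i - sampleMean (X n ω)) := by
  refine fun ε _ => ⟨0, (eventually_gt_atTop 0).mono fun n hn => ?_⟩
  simp [sum_sub_eq_smul_sampleMean_sub hn]

end Statistics

/-! ### Limit theorems for a data-dependent centre -/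

section Main

variable {m : ℕ} {Ω : ℕ → Type*} [∀ n, MeasurableSpace (Ω n)] {P : ∀ n, Measure (Ω n)}
  [∀ n, IsProbabilityMeasure (P n)] {X : ∀ n, Ω n → Fin n → Fin m → ℝ}
  {μ : ∀ n, (Fin n → Fin m → ℝ) → Fin m → ℝ}
  {R : ℕ → ℕ} {π : ∀ n, Ω n → Fin (R n) → Equiv.Perm (Fin n)}
  {S : Matrix (Fin m) (Fin m) ℝ} {δ : ℝ}

theorem mean_limits (hm : 0 < m) (hX : ∀ n, Measurable (X n)) (hμ : ∀ n, Measurable (μ n))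
    (hπ : ∀ n, Measurable (π n)) (hlaw : ∀ n, (P n).map (π n) = permLaw n (R n))
    (hdata : ∀ n, IndepFun (X n) (π n) (P n))
    (h_mean : BoundedInProb P fun n ω => (√(n : ℝ))⁻¹ • ∑ i, (X n ω i - μ n (X n ω)))
    (hS : S.PosDef) (h_var : ∀ j k, TendstoInProb P (fun n ω => sampleVar (X n ω) j k) (S j k))
    (hδ : 0 < δ) (h_mom : BoundedInProb P fun n ω => (n : ℝ)⁻¹ * ∑ i, ‖X n ω i‖ ^ (2 + δ))
    (hR : Tendsto R atTop atTop) (hRn : Tendsto (fun n => (R n : ℝ) / n) atTop (𝓝 0)) :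
    CondCDFTendsto P X (fun n ω => meanVec (X n ω) (μ n (X n ω)) (π n ω)) (stdNormal m) ∧
      TendstoInDistribution (fun n ω => meanStat (X n ω) (μ n (X n ω)) (π n ω)) atTop id P
        (chiSquare m) ∧
      CondCDFTendstoUniformly P X (fun n ω => meanStat (X n ω) (μ n (X n ω)) (π n ω))
        (chiSquare m) := by
  have hvar : ∀ jl : Fin m × Fin m, TendstoInProb P
      (fun n ω => sampleVar (X n ω) jl.1 jl.2) (S jl.1 jl.2) := fun jl => h_var jl.1 jl.2
  refine ⟨fun t => ?_, ?_, ?_⟩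
  · refine TendstoAlongData.tendstoInProb_condDistrib
      (T := fun n x g => meanVec x (μ n x) g) hX hπ hlaw hdata
      (fun n => measurable_meanVec (hμ n)) (tendstoAlongSamples_meanVec μ hS hδ hR hRn) h_mean
      h_mom hvar (fun ρ => ρ.real (Set.Iic t)) fun ρ hρ => ?_
    exact (ENNReal.tendsto_toReal (measure_ne_top _ _)).comp
      (ProbabilityMeasure.tendsto_measure_of_null_frontier_of_tendsto' hρ
        (stdNormal_frontier_Iic t))
  · exact TendstoAlongData.tendstoInDistribution
      (T := fun n x g => meanStat x (μ n x) g) hX hπ hlaw hdata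
      (fun n => measurable_meanStat (hμ n)) (tendstoAlongSamples_meanStat μ hS hδ hR hRn) h_mean
      h_mom hvar
  · exact TendstoAlongData.tendstoInProb_condDistrib
      (T := fun n x g => meanStat x (μ n x) g) hX hπ hlaw hdata
      (fun n => measurable_meanStat (hμ n)) (tendstoAlongSamples_meanStat μ hS hδ hR hRn) h_mean
      h_mom hvar (fun ρ => ⨆ t : ℝ, |ρ.real (Set.Iic t) - (chiSquare m).real (Set.Iic t)|)
      fun ρ hρ => tendsto_iSup_abs_sub_cdf (chiSquare_singleton hm) hρ

theorem uStat_limits (hm : 0 < m) (hX : ∀ n, Measurable (X n)) (hμ : ∀ n, Measurable (μ n))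
    (hπ : ∀ n, Measurable (π n)) (hlaw : ∀ n, (P n).map (π n) = permLaw n (R n))
    (hdata : ∀ n, IndepFun (X n) (π n) (P n))
    (h_mean : BoundedInProb P fun n ω => (√(n : ℝ))⁻¹ • ∑ i, (X n ω i - μ n (X n ω)))
    (hS : S.PosDef) (h_var : ∀ j k, TendstoInProb P (fun n ω => sampleVar (X n ω) j k) (S j k))
    (hδ : 0 < δ) (h_mom : BoundedInProb P fun n ω => (n : ℝ)⁻¹ * ∑ i, ‖X n ω i‖ ^ (2 + δ))
    (hR : Tendsto R atTop atTop) (hRn : Tendsto (fun n => √(R n : ℝ) / n) atTop (𝓝 0)) :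
    TendstoInDistribution (fun n ω => uStat (X n ω) (μ n (X n ω)) (π n ω)) atTop id P
        (gaussianReal 0 1) ∧
      CondCDFTendstoUniformly P X (fun n ω => uStat (X n ω) (μ n (X n ω)) (π n ω))
        (gaussianReal 0 1) := by
  have hvar : ∀ jl : Fin m × Fin m, TendstoInProb P
      (fun n ω => sampleVar (X n ω) jl.1 jl.2) (S jl.1 jl.2) := fun jl => h_var jl.1 jl.2
  refine ⟨?_, ?_⟩
  · exact TendstoAlongData.tendstoInDistribution
      (T := fun n x g => uStat x (μ n x) g) hX hπ hlaw hdata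
      (fun n => measurable_uStat (hμ n)) (tendstoAlongSamples_uStat μ hm hS hδ hR hRn) h_mean
      h_mom hvar
  · exact TendstoAlongData.tendstoInProb_condDistrib
      (T := fun n x g => uStat x (μ n x) g) hX hπ hlaw hdata
      (fun n => measurable_uStat (hμ n)) (tendstoAlongSamples_uStat μ hm hS hδ hR hRn) h_mean
      h_mom hvar (fun ρ => ⨆ t : ℝ, |ρ.real (Set.Iic t) - (gaussianReal 0 1).real (Set.Iic t)|)
      fun ρ hρ => tendsto_iSup_abs_sub_cdf gaussianReal_singleton hρ

end Main

end Resampling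

end

open Resampling in
theorem theorem1 {m : ℕ} (hm : 0 < m)
    -- the probability spaces; row `n` of the triangular array lives on the `n`-th one
    {Ω : ℕ → Type*} [∀ n, MeasurableSpace (Ω n)]
    (P : ∀ n, Measure (Ω n)) [∀ n, IsProbabilityMeasure (P n)]
    -- the data: `X n ω i` is the `i`-th observation in the sample of size `n`
    (X : ∀ n, Ω n → Fin n → Fin m → ℝ) (hX : ∀ n, Measurable (X n))
    (μ₀ : ℕ → Fin m → ℝ)
    -- i.i.d. uniform permutations, independent of the data
    (R : ℕ → ℕ) (hR : ∀ n, 1 ≤ R n)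
    (π : ∀ n, Ω n → Fin (R n) → Equiv.Perm (Fin n)) (hπ : ∀ n, Measurable (π n))
    (hπ_unif : ∀ n r, (P n).map (fun ω => π n ω r) = uniformOn Set.univ)
    (hπ_iid : ∀ n, iIndepFun (fun r ω => π n ω r) (P n))
    (hπ_data : ∀ n, IndepFun (X n) (π n) (P n))
    -- root-`n` consistency
    (h_mean : BoundedInProb P fun n ω => (√(n : ℝ))⁻¹ • ∑ i, (X n ω i - μ₀ n))
    -- convergence of the sample variance
    (S : Matrix (Fin m) (Fin m) ℝ) (hS : S.PosDef)
    (h_var : ∀ j k, TendstoInProb P (fun n ω => sampleVar (X n ω) j k) (S j k))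
    -- sample moments (the norm on `Fin m → ℝ` is the sup norm)
    (δ : ℝ) (hδ : 0 < δ)
    (h_mom : BoundedInProb P fun n ω => (n : ℝ)⁻¹ * ∑ i, ‖X n ω i‖ ^ (2 + δ))
    (hR_top : Tendsto R atTop atTop) :
    (Tendsto (fun n => (R n : ℝ) / n) atTop (𝓝 0) →
      (CondCDFTendsto P X (fun n ω => meanVec (X n ω) (μ₀ n) (π n ω)) (stdNormal m) ∧
        CondCDFTendsto P X (fun n ω => meanVec (X n ω) (sampleMean (X n ω)) (π n ω))
          (stdNormal m)) ∧
      (TendstoInDistribution (fun n ω => meanStat (X n ω) (μ₀ n) (π n ω)) atTop id P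
          (chiSquare m) ∧
        TendstoInDistribution (fun n ω => meanStat (X n ω) (sampleMean (X n ω)) (π n ω)) atTop id P
          (chiSquare m)) ∧
      (CondCDFTendstoUniformly P X (fun n ω => meanStat (X n ω) (μ₀ n) (π n ω)) (chiSquare m) ∧
        CondCDFTendstoUniformly P X (fun n ω => meanStat (X n ω) (sampleMean (X n ω)) (π n ω))
          (chiSquare m))) ∧
    (Tendsto (fun n => √(R n : ℝ) / n) atTop (𝓝 0) →
      (TendstoInDistribution (fun n ω => uStat (X n ω) (μ₀ n) (π n ω)) atTop id P
          (gaussianReal 0 1) ∧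
        TendstoInDistribution (fun n ω => uStat (X n ω) (sampleMean (X n ω)) (π n ω)) atTop id P
          (gaussianReal 0 1)) ∧
      (CondCDFTendstoUniformly P X (fun n ω => uStat (X n ω) (μ₀ n) (π n ω)) (gaussianReal 0 1) ∧
        CondCDFTendstoUniformly P X (fun n ω => uStat (X n ω) (sampleMean (X n ω)) (π n ω))
          (gaussianReal 0 1))) := by
  have hlaw : ∀ n, (P n).map (π n) = permLaw n (R n) := fun n =>
    map_eq_permLaw (hπ n) (hπ_unif n) (hπ_iid n)
  have hc : ∀ n, Measurable fun _ : Fin n → Fin m → ℝ => μ₀ n := fun n => measurable_const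
  have hs : ∀ n, Measurable (sampleMean : (Fin n → Fin m → ℝ) → Fin m → ℝ) := fun n =>
    continuous_sampleMean.measurable
  have h_mean' := boundedInProb_sampleMean_sub P X
  refine ⟨fun hRn => ?_, fun hRn => ?_⟩
  · obtain ⟨h1, h2, h3⟩ := mean_limits hm hX hc hπ hlaw hπ_data h_mean hS h_var hδ h_mom hR_top hRn
    obtain ⟨k1, k2, k3⟩ :=
      mean_limits hm hX hs hπ hlaw hπ_data h_mean' hS h_var hδ h_mom hR_top hRn
    exact ⟨⟨h1, k1⟩, ⟨h2, k2⟩, h3, k3⟩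
  · obtain ⟨h1, h2⟩ := uStat_limits hm hX hc hπ hlaw hπ_data h_mean hS h_var hδ h_mom hR_top hRn
    obtain ⟨k1, k2⟩ := uStat_limits hm hX hs hπ hlaw hπ_data h_mean' hS h_var hδ h_mom hR_top hRn
    exact ⟨⟨h1, k1⟩, h2, k2⟩
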